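/- Let $K$ be a finite extension of $\mathbb{Q}_p$ with ring of integers $\mathcal{O}$ and uniformizer $\pi$, and let $q$ be the order of the residue field. Let $R$ be a $\pi$-adically complete and separated, $\pi$-torsion free $\mathcal{O}$-algebra with an $\mathcal{O}$-algebra endomorphism $\phi$ such that $\phi(r)-r^q\in\pi R$ for all $r\in R$. Let $\mathrm{Nilp}_R$ be the category of $R$-algebras in which $\pi$ is nilpotent. A formal scheme over $R$ is a Zariski sheaf of sets $X$ on $\mathrm{Nilp}_R^{\mathrm{op}}$ with an open cover by functors $\mathrm{Spf}(A)\colon B\mapsto \varinjlim_m \mathrm{Hom}_R(A/I^m,B)$, where $A$ is an adic $R$-algebra with ideal of definition $I\ni\pi$; it is smooth if one can take $I=\pi A$ and every $A/\pi^mA$ smooth over $R/\pi^mR$. For $n\ge 0$ and an $R$-algebra $B$, let $W_n(B)$ be the ring of ramified ($\pi$-typical) Witt vectors $(b_0,\dots,b_n)$ of length $n+1$, with ghost components $w_i=\sum_{j=0}^{i}\pi^j b_j^{q^{i-j}}$, regarded as an $R$-algebra via $R\to W_n(R)\to W_n(B)$, where the first map is the unique ring homomorphism with ghost components $(\mathrm{id},\phi,\dots,\phi^n)$.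 Let $W_n^+(B)=R\times_B W_n(B)$ be the fibre product over the structure map $R\to B$ and $w_0\colon W_n(B)\to B$; it is augmented by the projection $w_0^+\colon W_n^+(B)\to R$. Let $X$ be a smooth formal scheme over $R$ with a marked point $x\colon \mathrm{Spf}(R)\to X$, let $J^nX(B)=X(W_n(B))$ with natural map $u=X(w_0)\colon J^nX\to X$, and let $N^nX=J^nX\times_{X,x}\mathrm{Spf}(R)$ be the fibre of $u$ at $x$. Then, for every $B$ in $\mathrm{Nilp}_R$, the $R$-algebra $W_n^+(B)$ is $\pi$-adically complete and separated, and restriction along $\mathrm{Spf}(W_n(B))\to\mathrm{Spf}(W_n^+(B))$ defines a bijection, natural in $B$, $$\{f\in \mathrm{Hom}_R(\mathrm{Spf}(W_n^+(B)),X) : f\circ \mathrm{Spf}(w_0^+)=x\}\;\xrightarrow{\ \sim\ }\; N^nX(B),$$ where $\mathrm{Spf}(W_n^+(B))$ carries the $\pi$-adic topology. -/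

import Mathlib

open CategoryTheory

namespace PiJet

universe u v

/-! ### Ramified Witt vectors of finite length -/

/-- The standing assumption on the coefficient ring of ramified Witt vectors: `π` is a prime element
with finite residue ring (so `O ⧸ (π)` is a finite field). -/
class IsUniformizer {O : Type v} [CommRing O] (π : O) : Prop where
  prime : Prime π
  finite : Finite (O ⧸ Ideal.span {π})

/-- The order `q` of the residue field `O ⧸ (π)`. -/
noncomputable def residueCard {O : Type v} [CommRing O] (π : O) : ℕ :=
  Nat.card (O ⧸ Ideal.span {π})

section Residue

variable {O : Type v} [CommRing O] (π : O) [IsUniformizer π]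

theorem residueCard_spec : ∃ p k : ℕ, p.Prime ∧ 0 < k ∧ residueCard π = p ^ k ∧ π ∣ (p : O) ∧
    ∀ x : O, π ∣ x ^ residueCard π - x := by
  have hp : (Ideal.span {π}).IsPrime :=
    (Ideal.span_singleton_prime (IsUniformizer.prime (π := π)).ne_zero).2 IsUniformizer.prime
  have := IsUniformizer.finite (π := π)
  let := Fintype.ofFinite (O ⧸ Ideal.span {π})
  classical
  let := Fintype.fieldOfDomain (O ⧸ Ideal.span {π})
  obtain ⟨p, hc, k, hpp, hk⟩ := FiniteField.card' (O ⧸ Ideal.span {π})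
  refine ⟨p, k, hpp, k.2, ?_, ?_, fun x => ?_⟩
  · rw [residueCard, Nat.card_eq_fintype_card, hk]
  · rw [← Ideal.mem_span_singleton, ← Ideal.Quotient.eq_zero_iff_mem, map_natCast]
    exact hc.cast_eq_zero
  · rw [← Ideal.mem_span_singleton, ← Ideal.Quotient.eq_zero_iff_mem, map_sub, map_pow,
      residueCard, Nat.card_eq_fintype_card, FiniteField.pow_card, sub_self]

theorem dvd_residueCard : π ∣ (residueCard π : O) := by
  obtain ⟨p, k, -, hk, h, hp, -⟩ := residueCard_spec π
  rw [h, Nat.cast_pow]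
  exact dvd_pow hp hk.ne'

theorem residueCard_pos : 0 < residueCard π := by
  obtain ⟨p, k, hpp, hk, h, -⟩ := residueCard_spec π
  rw [h]; exact pow_pos hpp.pos _

variable {A : Type*} [CommRing A] [Algebra O A]

theorem dvd_add_pow_sub (x y : A) : algebraMap O A π ∣
    (x + y) ^ residueCard π - (x ^ residueCard π + y ^ residueCard π) := by
  obtain ⟨p, k, hpp, -, h, hp, -⟩ := residueCard_spec π
  obtain ⟨r, hr⟩ := exists_add_pow_prime_pow_eq hpp x y k
  rw [h, hr, add_sub_cancel_left]
  have := map_dvd (algebraMap O A) hp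
  rw [map_natCast] at this
  simpa only [mul_assoc] using this.mul_right (x * (y * r))

theorem dvd_pow_sub_pow {k : ℕ} (hk : 0 < k) {x y : A} (h : algebraMap O A π ^ k ∣ x - y) :
    algebraMap O A π ^ (k + 1) ∣ x ^ residueCard π - y ^ residueCard π := by
  rw [← (Commute.all x y).geom_sum₂_mul, pow_succ, mul_comm]
  have := map_dvd (algebraMap O A) (dvd_residueCard π)
  rw [map_natCast] at this
  exact mul_dvd_mul ((dvd_geom_sum₂_iff_of_dvd_sub ((dvd_pow_self _ hk.ne').trans h)).2
    (this.mul_right _)) h |>.trans (by rw [mul_comm])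

theorem dvd_pow_pow_sub {x y : A} (h : algebraMap O A π ∣ x - y) (m : ℕ) :
    algebraMap O A π ^ (m + 1) ∣ x ^ residueCard π ^ m - y ^ residueCard π ^ m := by
  induction m with
  | zero => simpa using h
  | succ m ih =>
    rw [pow_succ (residueCard π), pow_mul, pow_mul]
    exact dvd_pow_sub_pow π m.succ_pos ih

/-- The polynomial ring carries the lift of Frobenius raising the variables to the `q`-th power. -/
theorem dvd_expand_sub {σ : Type*} (f : MvPolynomial σ O) :
    algebraMap O (MvPolynomial σ O) π ∣
      MvPolynomial.expand (residueCard π) f - f ^ residueCard π := by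
  induction f using MvPolynomial.induction_on with
  | C a =>
    obtain ⟨p, k, -, -, -, -, h⟩ := residueCard_spec π
    have := map_dvd (algebraMap O (MvPolynomial σ O)) (h a)
    rw [map_sub, map_pow] at this
    rw [dvd_sub_comm]
    simpa [MvPolynomial.algebraMap_eq] using this
  | add f g hf hg =>
    have := dvd_sub (dvd_add hf hg) (dvd_add_pow_sub π f g)
    convert this using 1
    rw [map_add]; ring
  | mul_X f i hf =>
    have := hf.mul_right ((MvPolynomial.X i : MvPolynomial σ O) ^ residueCard π)
    convert this using 1
    rw [map_mul, MvPolynomial.expand_X]; ring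

end Residue

section Ghost

variable {O : Type v} [CommRing O] (π : O) {A : Type*} [CommRing A] [Algebra O A]

/-- The `i`-th ghost component `a₀ ^ (q ^ i) + π a₁ ^ (q ^ (i - 1)) + ⋯ + π ^ i aᵢ`
of a vector `(a₀, …, aₙ)`, for `i ≤ n`. -/
noncomputable def ghost {n : ℕ} (a : Fin (n + 1) → A) (i : ℕ) : A :=
  ∑ j : Fin (n + 1), if (j : ℕ) ≤ i then
    algebraMap O A π ^ (j : ℕ) * a j ^ residueCard π ^ (i - j) else 0

theorem ghost_restrict {n : ℕ} (a : ℕ → A) {i : ℕ} (hi : i ≤ n) :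
    ghost π (fun j : Fin (n + 1) => a j) i =
      ∑ j ∈ Finset.range (i + 1), algebraMap O A π ^ j * a j ^ residueCard π ^ (i - j) := by
  rw [ghost, ← Finset.sum_range (fun j => if j ≤ i then
    algebraMap O A π ^ j * a j ^ residueCard π ^ (i - j) else 0), ← Finset.sum_filter]
  congr 1
  ext j
  simp only [Finset.mem_filter, Finset.mem_range]
  omega

theorem ghost_zero {n : ℕ} (a : Fin (n + 1) → A) : ghost π a 0 = a 0 := by
  rw [ghost, Finset.sum_eq_single 0]
  · simp
  · intro j _ hj
    rw [if_neg]
    intro h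
    exact hj (Fin.ext (by simpa using h))
  · simp

theorem map_ghost {B : Type*} [CommRing B] [Algebra O B] (f : A →ₐ[O] B) {n : ℕ}
    (a : Fin (n + 1) → A) (i : ℕ) : f (ghost π a i) = ghost π (fun j => f (a j)) i := by
  simp only [ghost, map_sum]
  refine Finset.sum_congr rfl fun j _ => ?_
  split_ifs <;> simp

theorem ghost_succ_sub {n : ℕ} (a : Fin (n + 1) → A) (i : ℕ) : algebraMap O A π ^ (i + 1) ∣
    ghost π a (i + 1) - ghost π (fun j => a j ^ residueCard π) i := by
  rw [ghost, ghost, ← Finset.sum_sub_distrib]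
  refine Finset.dvd_sum fun j _ => ?_
  split_ifs with h1 h2 h2
  · rw [← pow_mul, ← pow_succ', show i - j + 1 = i + 1 - j by omega, sub_self]
    exact dvd_zero _
  · have : (j : ℕ) = i + 1 := by omega
    rw [this, sub_zero]
    exact Dvd.intro _ rfl
  · omega
  · simp

theorem ghost_injective (hA : ∀ a : A, algebraMap O A π * a = 0 → a = 0) {n : ℕ}
    {a b : Fin (n + 1) → A} (h : ∀ i ≤ n, ghost π a i = ghost π b i) : a = b := by
  have hA' : ∀ (m : ℕ) (a : A), algebraMap O A π ^ m * a = 0 → a = 0 := by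
    intro m
    induction m with
    | zero => simp
    | succ m ih =>
      intro a ha
      rw [pow_succ, mul_assoc] at ha
      exact hA _ (ih _ ha)
  have key : ∀ i : ℕ, ∀ hi : i < n + 1, a ⟨i, hi⟩ = b ⟨i, hi⟩ := by
    intro i
    induction i using Nat.strong_induction_on with
    | _ i ih =>
      intro hi
      have := h i (by omega)
      rw [← sub_eq_zero, ghost, ghost, ← Finset.sum_sub_distrib,
        Finset.sum_eq_single ⟨i, hi⟩] at this
      · simp only [le_refl, if_true, Nat.sub_self, pow_zero, pow_one, ← mul_sub] at this
        exact sub_eq_zero.1 (hA' _ _ this)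
      · intro j _ hj
        split_ifs with hji
        · have hlt : (j : ℕ) < i := lt_of_le_of_ne hji fun e => hj (Fin.ext e)
          rw [show a j = b j from ih j hlt j.2, sub_self]
        · simp
      · simp
  exact funext fun i => key i i.2

/-- Dwork's lemma: over a ring with a lift `σ` of the `q`-power Frobenius, a sequence with
`g (i + 1) ≡ σ (g i)` modulo `π ^ (i + 1)` is a sequence of ghost components. -/
theorem exists_ghost_eq [IsUniformizer π] (σ : A →ₐ[O] A)
    (hσ : ∀ a, algebraMap O A π ∣ σ a - a ^ residueCard π) (n : ℕ) (g : ℕ → A)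
    (hg : ∀ i < n, algebraMap O A π ^ (i + 1) ∣ g (i + 1) - σ (g i)) :
    ∃ a : Fin (n + 1) → A, ∀ i ≤ n, ghost π a i = g i := by
  suffices H : ∀ m ≤ n, ∃ a : ℕ → A, ∀ i ≤ m, ∑ j ∈ Finset.range (i + 1),
      algebraMap O A π ^ j * a j ^ residueCard π ^ (i - j) = g i by
    obtain ⟨a, ha⟩ := H n le_rfl
    exact ⟨fun j => a j, fun i hi => (ghost_restrict π a hi).trans (ha i hi)⟩
  intro m
  induction m with
  | zero => exact fun _ => ⟨fun _ => g 0, fun i hi => by simp [Nat.le_zero.1 hi]⟩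
  | succ m ih =>
    intro hm
    obtain ⟨a, ha⟩ := ih (by omega)
    have hdvd : algebraMap O A π ^ (m + 1) ∣ g (m + 1) - ∑ j ∈ Finset.range (m + 1),
        algebraMap O A π ^ j * a j ^ residueCard π ^ (m + 1 - j) := by
      have h1 := hg m (by omega)
      have h2 : algebraMap O A π ^ (m + 1) ∣ σ (g m) - ∑ j ∈ Finset.range (m + 1),
          algebraMap O A π ^ j * a j ^ residueCard π ^ (m + 1 - j) := by
        rw [← ha m le_rfl, map_sum, ← Finset.sum_sub_distrib]
        refine Finset.dvd_sum fun j hj => ?_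
        rw [Finset.mem_range] at hj
        rw [map_mul, map_pow, map_pow, AlgHom.commutes, ← mul_sub,
          show m + 1 = j + (m - j + 1) by omega, pow_add,
          show j + (m - j + 1) - j = (m - j) + 1 by omega, pow_succ' (residueCard π), pow_mul]
        exact mul_dvd_mul_left _ (dvd_pow_pow_sub π (hσ _) _)
      have := dvd_add h1 h2
      rwa [sub_add_sub_cancel] at this
    obtain ⟨c, hc⟩ := hdvd
    refine ⟨Function.update a (m + 1) c, fun i hi => ?_⟩
    rcases Nat.lt_or_ge i (m + 1) with h | h
    · rw [← ha i (by omega)]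
      refine Finset.sum_congr rfl fun j hj => ?_
      rw [Finset.mem_range] at hj
      rw [Function.update_of_ne (by omega)]
    · obtain rfl : i = m + 1 := by omega
      rw [Finset.sum_range_succ, Function.update_self, Nat.sub_self, pow_zero, pow_one, ← hc]
      rw [Finset.sum_congr rfl fun j hj => by
        rw [Function.update_of_ne (by rw [Finset.mem_range] at hj; omega)]]
      ring

end Ghost

section StructurePolynomials

variable {O : Type v} [CommRing O] (π : O) [IsUniformizer π]

theorem exists_structPoly (n : ℕ) {κ : Type} (Φ : MvPolynomial κ O) :
    ∃ S : Fin (n + 1) → MvPolynomial (κ × Fin (n + 1)) O, ∀ i ≤ n, ghost π S i =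
      MvPolynomial.aeval (fun k => ghost π (fun j => MvPolynomial.X (k, j)) i) Φ := by
  refine exists_ghost_eq π (MvPolynomial.expand (residueCard π)) (dvd_expand_sub π) n
    (fun i => MvPolynomial.aeval (fun k => ghost π (fun j => MvPolynomial.X (k, j)) i) Φ) ?_
  intro i _
  rw [← AlgHom.comp_apply, MvPolynomial.comp_aeval]
  simp only [map_ghost, MvPolynomial.expand_X]
  rw [← Ideal.mem_span_singleton, ← Ideal.Quotient.mk_eq_mk_iff_sub_mem]
  rw [← Ideal.Quotient.mkₐ_eq_mk O, ← AlgHom.comp_apply, ← AlgHom.comp_apply,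
    MvPolynomial.comp_aeval, MvPolynomial.comp_aeval]
  congr 2
  funext k
  rw [Ideal.Quotient.mkₐ_eq_mk, Ideal.Quotient.mk_eq_mk_iff_sub_mem, Ideal.mem_span_singleton]
  exact ghost_succ_sub π _ i

/-- The Witt polynomials attached to the polynomial operation `Φ`: the unique polynomials `S` with
`wᵢ(S₀, …, Sₙ) = Φ((wᵢ(X_{k,0}, …, X_{k,n}))ₖ)` for all `i ≤ n`. -/
noncomputable def structPoly (n : ℕ) {κ : Type} (Φ : MvPolynomial κ O) :
    Fin (n + 1) → MvPolynomial (κ × Fin (n + 1)) O :=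
  (exists_structPoly π n Φ).choose

theorem ghost_structPoly (n : ℕ) {κ : Type} (Φ : MvPolynomial κ O) {i : ℕ} (hi : i ≤ n) :
    ghost π (structPoly π n Φ) i =
      MvPolynomial.aeval (fun k => ghost π (fun j => MvPolynomial.X (k, j)) i) Φ :=
  (exists_structPoly π n Φ).choose_spec i hi

end StructurePolynomials

/-- The ramified (`π`-typical) Witt vectors `W_n(B)` of length `n + 1` over the `O`-algebra `B`. -/
@[ext]
structure Witt {O : Type v} [CommRing O] (π : O) (n : ℕ) (B : Type u) where
  coeff : Fin (n + 1) → B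

namespace Witt

variable {O : Type v} [CommRing O] (π : O) [IsUniformizer π] {n : ℕ}
variable {B : Type u} [CommRing B] [Algebra O B]

/-- The operation on Witt vectors which is the polynomial operation `Φ` on ghost components. -/
noncomputable def op {κ : Type} (Φ : MvPolynomial κ O) (v : κ → Witt π n B) : Witt π n B :=
  ⟨fun i => MvPolynomial.aeval (fun kj : κ × Fin (n + 1) => (v kj.1).coeff kj.2)
    (structPoly π n Φ i)⟩

variable {π}

theorem ghost_op {κ : Type} (Φ : MvPolynomial κ O) (v : κ → Witt π n B) {i : ℕ} (hi : i ≤ n) :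
    ghost π (op π Φ v).coeff i = MvPolynomial.aeval (fun k => ghost π (v k).coeff i) Φ := by
  rw [op, ← map_ghost, ghost_structPoly π n Φ hi, ← AlgHom.comp_apply, MvPolynomial.comp_aeval]
  simp only [map_ghost, MvPolynomial.aeval_X]

/-- Functoriality of Witt vectors: a map is applied to the coordinates. -/
def mapFun {C : Type*} (f : B → C) (a : Witt π n B) : Witt π n C := ⟨fun i => f (a.coeff i)⟩

theorem mapFun_op {C : Type*} [CommRing C] [Algebra O C] (f : B →ₐ[O] C) {κ : Type}
    (Φ : MvPolynomial κ O) (v : κ → Witt π n B) :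
    mapFun f (op π Φ v) = op π Φ (fun k => mapFun f (v k)) := by
  ext i
  simp only [mapFun, op]
  rw [← AlgHom.comp_apply, MvPolynomial.comp_aeval]

noncomputable instance : Zero (Witt π n B) := ⟨op π (0 : MvPolynomial Empty O) Empty.elim⟩
noncomputable instance : One (Witt π n B) := ⟨op π (1 : MvPolynomial Empty O) Empty.elim⟩
noncomputable instance : Add (Witt π n B) :=
  ⟨fun a b => op π (MvPolynomial.X 0 + MvPolynomial.X 1 : MvPolynomial (Fin 2) O) ![a, b]⟩
noncomputable instance : Mul (Witt π n B) :=
  ⟨fun a b => op π (MvPolynomial.X 0 * MvPolynomial.X 1 : MvPolynomial (Fin 2) O) ![a, b]⟩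
noncomputable instance : Neg (Witt π n B) :=
  ⟨fun a => op π (-MvPolynomial.X 0 : MvPolynomial (Fin 1) O) ![a]⟩
noncomputable instance : Sub (Witt π n B) :=
  ⟨fun a b => op π (MvPolynomial.X 0 - MvPolynomial.X 1 : MvPolynomial (Fin 2) O) ![a, b]⟩
noncomputable instance : SMul ℕ (Witt π n B) :=
  ⟨fun m a => op π (m • MvPolynomial.X 0 : MvPolynomial (Fin 1) O) ![a]⟩
noncomputable instance : SMul ℤ (Witt π n B) :=
  ⟨fun m a => op π (m • MvPolynomial.X 0 : MvPolynomial (Fin 1) O) ![a]⟩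
noncomputable instance : Pow (Witt π n B) ℕ :=
  ⟨fun a m => op π (MvPolynomial.X 0 ^ m : MvPolynomial (Fin 1) O) ![a]⟩
noncomputable instance : NatCast (Witt π n B) :=
  ⟨fun m => op π (m : MvPolynomial Empty O) Empty.elim⟩
noncomputable instance : IntCast (Witt π n B) :=
  ⟨fun m => op π (m : MvPolynomial Empty O) Empty.elim⟩

/-- The vector of ghost components. -/
noncomputable def ghostFun (a : Witt π n B) : Fin (n + 1) → B := fun i => ghost π a.coeff i

theorem ghostFun_op {κ : Type} (Φ : MvPolynomial κ O) (v : κ → Witt π n B) (i : Fin (n + 1)) :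
    ghostFun (op π Φ v) i = MvPolynomial.aeval (fun k => ghostFun (v k) i) Φ :=
  ghost_op Φ v (Nat.lt_succ_iff.1 i.2)

theorem ghostFun_injective (hB : ∀ b : B, algebraMap O B π * b = 0 → b = 0) :
    Function.Injective (ghostFun : Witt π n B → Fin (n + 1) → B) := fun a b h => by
  have := ghost_injective π hB (a := a.coeff) (b := b.coeff) (fun i hi =>
    congrFun h ⟨i, Nat.lt_succ_of_le hi⟩)
  exact Witt.ext this

theorem ghostFun_zero : ghostFun (0 : Witt π n B) = 0 := by
  funext i; exact (ghostFun_op _ _ i).trans (by simp)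
theorem ghostFun_one : ghostFun (1 : Witt π n B) = 1 := by
  funext i; exact (ghostFun_op _ _ i).trans (by simp)
theorem ghostFun_add (a b : Witt π n B) : ghostFun (a + b) = ghostFun a + ghostFun b := by
  funext i; exact (ghostFun_op _ _ i).trans (by simp)
theorem ghostFun_mul (a b : Witt π n B) : ghostFun (a * b) = ghostFun a * ghostFun b := by
  funext i; exact (ghostFun_op _ _ i).trans (by simp)
theorem ghostFun_neg (a : Witt π n B) : ghostFun (-a) = -ghostFun a := by
  funext i; exact (ghostFun_op _ _ i).trans (by simp)
theorem ghostFun_sub (a b : Witt π n B) : ghostFun (a - b) = ghostFun a - ghostFun b := by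
  funext i; exact (ghostFun_op _ _ i).trans (by simp)
theorem ghostFun_nsmul (m : ℕ) (a : Witt π n B) : ghostFun (m • a) = m • ghostFun a := by
  funext i; exact (ghostFun_op _ _ i).trans (by simp)
theorem ghostFun_zsmul (m : ℤ) (a : Witt π n B) : ghostFun (m • a) = m • ghostFun a := by
  funext i; exact (ghostFun_op _ _ i).trans (by simp)
theorem ghostFun_pow (a : Witt π n B) (m : ℕ) : ghostFun (a ^ m) = ghostFun a ^ m := by
  funext i; exact (ghostFun_op _ _ i).trans (by simp)
theorem ghostFun_natCast (m : ℕ) : ghostFun (m : Witt π n B) = m := by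
  funext i; exact (ghostFun_op _ _ i).trans (by simp)
theorem ghostFun_intCast (m : ℤ) : ghostFun (m : Witt π n B) = m := by
  funext i; exact (ghostFun_op _ _ i).trans (by simp)

section Map

variable {C : Type*} [CommRing C] [Algebra O C] (f : B →ₐ[O] C)

theorem mapFun_op_eq {κ : Type} (Φ : MvPolynomial κ O) (v : κ → Witt π n B)
    (w : κ → Witt π n C) (h : ∀ k, mapFun f (v k) = w k) :
    mapFun f (op π Φ v) = op π Φ w := by
  rw [mapFun_op]; congr 1; exact funext h

theorem mapFun_zero : mapFun f (0 : Witt π n B) = 0 := mapFun_op_eq f _ _ _ (by simp)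
theorem mapFun_one : mapFun f (1 : Witt π n B) = 1 := mapFun_op_eq f _ _ _ (by simp)
theorem mapFun_add (a b : Witt π n B) : mapFun f (a + b) = mapFun f a + mapFun f b :=
  mapFun_op_eq f _ _ _ (by simp [Fin.forall_fin_two])
theorem mapFun_mul (a b : Witt π n B) : mapFun f (a * b) = mapFun f a * mapFun f b :=
  mapFun_op_eq f _ _ _ (by simp [Fin.forall_fin_two])
theorem mapFun_neg (a : Witt π n B) : mapFun f (-a) = -mapFun f a :=
  mapFun_op_eq f _ _ _ (by simp)
theorem mapFun_sub (a b : Witt π n B) : mapFun f (a - b) = mapFun f a - mapFun f b :=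
  mapFun_op_eq f _ _ _ (by simp [Fin.forall_fin_two])
theorem mapFun_nsmul (m : ℕ) (a : Witt π n B) : mapFun f (m • a) = m • mapFun f a :=
  mapFun_op_eq f _ _ _ (by simp)
theorem mapFun_zsmul (m : ℤ) (a : Witt π n B) : mapFun f (m • a) = m • mapFun f a :=
  mapFun_op_eq f _ _ _ (by simp)
theorem mapFun_pow (a : Witt π n B) (m : ℕ) : mapFun f (a ^ m) = mapFun f a ^ m :=
  mapFun_op_eq f _ _ _ (by simp)
theorem mapFun_natCast (m : ℕ) : mapFun f (m : Witt π n B) = m := mapFun_op_eq f _ _ _ (by simp)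
theorem mapFun_intCast (m : ℤ) : mapFun f (m : Witt π n B) = m := mapFun_op_eq f _ _ _ (by simp)

end Map

variable [IsDomain O]

/-- The ring axioms over the (`π`-torsion free) polynomial ring, from the ghost map. -/
noncomputable abbrev polyCommRing (σ : Type u) : CommRing (Witt π n (MvPolynomial σ O)) :=
  Function.Injective.commRing ghostFun
    (ghostFun_injective fun _ hb => (mul_eq_zero.1 hb).resolve_left fun h =>
      (IsUniformizer.prime (π := π)).ne_zero (MvPolynomial.C_eq_zero.1 h))
    ghostFun_zero ghostFun_one ghostFun_add ghostFun_mul ghostFun_neg ghostFun_sub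
    (fun m a => ghostFun_nsmul m a) (fun m a => ghostFun_zsmul m a) ghostFun_pow
    ghostFun_natCast ghostFun_intCast

noncomputable instance : CommRing (Witt π n B) :=
  letI := polyCommRing (π := π) (n := n) B
  Function.Surjective.commRing
    (mapFun (MvPolynomial.aeval (id : B → B) : MvPolynomial B O →ₐ[O] B))
    (fun a => ⟨⟨fun i => MvPolynomial.X (a.coeff i)⟩, by ext i; simp [mapFun]⟩)
    (mapFun_zero _) (mapFun_one _) (mapFun_add _) (mapFun_mul _) (mapFun_neg _) (mapFun_sub _)
    (fun m a => mapFun_nsmul _ m a) (fun m a => mapFun_zsmul _ m a) (mapFun_pow _)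
    (mapFun_natCast _) (mapFun_intCast _)

/-- The `i`-th ghost map `w_i : W_n(B) → B`. -/
noncomputable def ghostHom (i : Fin (n + 1)) : Witt π n B →+* B where
  toFun a := ghostFun a i
  map_zero' := congrFun ghostFun_zero i
  map_one' := congrFun ghostFun_one i
  map_add' a b := congrFun (ghostFun_add a b) i
  map_mul' a b := congrFun (ghostFun_mul a b) i

/-- The ring homomorphism `W_n(f) : W_n(B) → W_n(C)`. -/
noncomputable def map {C : Type*} [CommRing C] [Algebra O C] (f : B →ₐ[O] C) :
    Witt π n B →+* Witt π n C where
  toFun := mapFun f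
  map_zero' := mapFun_zero f
  map_one' := mapFun_one f
  map_add' := mapFun_add f
  map_mul' := mapFun_mul f

end Witt

/-! ### The base ring and the `R`-algebra structure on Witt vectors -/

/-- The standing assumptions on the base ring `R`: a `π`-adically complete (and separated),
`π`-torsion free `O`-algebra with an `O`-linear lift `φ` of the `q`-power Frobenius. -/
class FrobeniusBase {O : Type v} [CommRing O] (π : O) (R : Type u) [CommRing R] [Algebra O R] where
  φ : R →ₐ[O] R
  dvd_φ_sub : ∀ r : R, algebraMap O R π ∣ φ r - r ^ residueCard π
  torsionFree : ∀ r : R, algebraMap O R π * r = 0 → r = 0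
  complete : IsAdicComplete (Ideal.span {algebraMap O R π}) R

section BaseAlgebra

variable {O : Type v} [CommRing O] [IsDomain O] (π : O) [IsUniformizer π]
variable (R : Type u) [CommRing R] [Algebra O R] [FrobeniusBase π R]

theorem exists_expWitt (n : ℕ) (r : R) :
    ∃ a : Witt π n R, ∀ i ≤ n, ghost π a.coeff i = (FrobeniusBase.φ π)^[i] r := by
  obtain ⟨a, ha⟩ := exists_ghost_eq π (FrobeniusBase.φ π (R := R)) FrobeniusBase.dvd_φ_sub n
    (fun i => (FrobeniusBase.φ π)^[i] r) (fun i _ => by simp [Function.iterate_succ_apply'])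
  exact ⟨⟨a⟩, ha⟩

/-- The unique ring homomorphism `exp_δ : R → W_n(R)` with ghost components
`(id, φ, …, φ ^ n)`. -/
noncomputable def expWitt (n : ℕ) : R →+* Witt π n R :=
  have hinj : ∀ a b : Witt π n R, Witt.ghostFun a = Witt.ghostFun b → a = b := fun _ _ h =>
    Witt.ghostFun_injective (FrobeniusBase.torsionFree (π := π)) h
  have hsp : ∀ (r : R) (i : Fin (n + 1)), Witt.ghostFun (exists_expWitt π R n r).choose i =
      (FrobeniusBase.φ π)^[i] r := fun r i =>
    (exists_expWitt π R n r).choose_spec i (Nat.lt_succ_iff.1 i.2)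
  { toFun := fun r => (exists_expWitt π R n r).choose
    map_zero' := hinj _ _ (funext fun i => by
      rw [hsp, Witt.ghostFun_zero, iterate_map_zero]; rfl)
    map_one' := hinj _ _ (funext fun i => by
      rw [hsp, Witt.ghostFun_one, iterate_map_one]; rfl)
    map_add' := fun r s => hinj _ _ (funext fun i => by
      rw [Witt.ghostFun_add, Pi.add_apply, hsp, hsp, hsp, iterate_map_add])
    map_mul' := fun r s => hinj _ _ (funext fun i => by
      rw [Witt.ghostFun_mul, Pi.mul_apply, hsp, hsp, hsp, iterate_map_mul]) }

theorem ghost_expWitt (n : ℕ) (r : R) {i : ℕ} (hi : i ≤ n) :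
    ghost π (expWitt π R n r).coeff i = (FrobeniusBase.φ π)^[i] r :=
  (exists_expWitt π R n r).choose_spec i hi

end BaseAlgebra

namespace Witt

variable {O : Type v} [CommRing O] [IsDomain O] {π : O} [IsUniformizer π]
variable {R : Type u} [CommRing R] [Algebra O R] [FrobeniusBase π R] {n : ℕ}
variable {B : Type u} [CommRing B] [Algebra O B] [Algebra R B] [IsScalarTower O R B]

/-- The `R`-algebra structure `R → W_n(R) → W_n(B)` on `W_n(B)`. -/
noncomputable instance : Algebra R (Witt π n B) :=
  ((map (IsScalarTower.toAlgHom O R B)).comp (expWitt π R n)).toAlgebra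

theorem algebraMap_eq (r : R) : algebraMap R (Witt π n B) r =
    map (IsScalarTower.toAlgHom O R B) (expWitt π R n r) := rfl

/-- The `R`-algebra homomorphism `W_n(f) : W_n(B) → W_n(C)`. -/
noncomputable def mapₐ {C : Type u} [CommRing C] [Algebra O C] [Algebra R C] [IsScalarTower O R C]
    (f : B →ₐ[R] C) : Witt π n B →ₐ[R] Witt π n C where
  __ := map (f.restrictScalars O)
  commutes' r := by
    ext i
    exact f.commutes _

variable (π R n B) in
/-- The projection `w₀ : W_n(B) → B`, `(b₀, …, bₙ) ↦ b₀`. -/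
noncomputable def w₀ : Witt π n B →ₐ[R] B where
  toFun a := a.coeff 0
  map_zero' := by
    have h := map_zero (ghostHom 0 : Witt π n B →+* B)
    rwa [show ghostHom 0 (0 : Witt π n B) = _ from ghost_zero π _] at h
  map_one' := by
    have h := map_one (ghostHom 0 : Witt π n B →+* B)
    rwa [show ghostHom 0 (1 : Witt π n B) = _ from ghost_zero π _] at h
  map_add' a b := by
    have h := map_add (ghostHom 0 : Witt π n B →+* B) a b
    rwa [show ghostHom 0 a = _ from ghost_zero π _, show ghostHom 0 b = _ from ghost_zero π _,
      show ghostHom 0 (a + b) = _ from ghost_zero π _] at h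
  map_mul' a b := by
    have h := map_mul (ghostHom 0 : Witt π n B →+* B) a b
    rwa [show ghostHom 0 a = _ from ghost_zero π _, show ghostHom 0 b = _ from ghost_zero π _,
      show ghostHom 0 (a * b) = _ from ghost_zero π _] at h
  commutes' r := by
    have h := ghost_expWitt π R n r n.zero_le
    rw [ghost_zero] at h
    exact congrArg (algebraMap R B) h

/-- If `π` is nilpotent in `B`, it is nilpotent in `W_n(B)`. -/
theorem isNilpotent (h : IsNilpotent (algebraMap R B (algebraMap O R π))) :
    IsNilpotent (algebraMap R (Witt π n B) (algebraMap O R π)) := by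
  obtain ⟨N, hN⟩ := h
  refine ⟨N + n, ?_⟩
  set ϖ := algebraMap O R π with hϖ
  have tf : ∀ (m : ℕ) (r : R), ϖ ^ m * r = 0 → r = 0 := by
    intro m
    induction m with
    | zero => simp
    | succ m ih =>
      intro a ha
      rw [pow_succ, mul_assoc] at ha
      exact FrobeniusBase.torsionFree (π := π) _ (ih _ ha)
  have key : ∀ i : ℕ, ∀ hi : i < n + 1,
      ϖ ^ (N + n - i) ∣ (expWitt π R n (ϖ ^ (N + n))).coeff ⟨i, hi⟩ := by
    intro i
    induction i using Nat.strong_induction_on with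
    | _ i ih =>
      intro hi
      have hg := ghost_expWitt π R n (ϖ ^ (N + n)) (Nat.lt_succ_iff.1 hi)
      have hφ : (FrobeniusBase.φ π)^[i] (ϖ ^ (N + n)) = ϖ ^ (N + n) := by
        rw [iterate_map_pow]
        congr 1
        exact Function.iterate_fixed (AlgHom.commutes _ _) i
      rw [hφ, ghost, ← Finset.add_sum_erase _ _ (Finset.mem_univ ⟨i, hi⟩)] at hg
      simp only [le_refl, if_true, Nat.sub_self, pow_zero, pow_one] at hg
      have hd : ϖ ^ (N + n) ∣ ϖ ^ i * (expWitt π R n (ϖ ^ (N + n))).coeff ⟨i, hi⟩ := by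
        rw [← hϖ] at hg
        refine (dvd_add_left (Finset.dvd_sum fun j hj => ?_)).1 (dvd_of_eq hg.symm)
        split_ifs with hji
        · have hne : j ≠ ⟨i, hi⟩ := (Finset.mem_erase.1 hj).1
          have hlt : (j : ℕ) < i := lt_of_le_of_ne hji fun e => hne (Fin.ext e)
          have e : ϖ ^ (N + n) = ϖ ^ (j : ℕ) * ϖ ^ (N + n - j) := by
            rw [← pow_add]; congr 1; omega
          exact (dvd_of_eq e).trans (mul_dvd_mul_left _
            (dvd_pow (ih j hlt j.2) (pow_pos (residueCard_pos π) _).ne'))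
        · exact dvd_zero _
      obtain ⟨c, hc⟩ := hd
      refine ⟨c, sub_eq_zero.1 (tf i _ ?_)⟩
      rw [mul_sub, hc, ← mul_assoc, ← pow_add, show i + (N + n - i) = N + n by omega, sub_self]
  rw [← map_pow, algebraMap_eq]
  ext i
  have h0 : ∀ i, (0 : Witt π n B).coeff i = 0 := by
    intro i
    have h := congrArg (fun a : Witt π n B => a.coeff i)
      (map_zero (map (IsScalarTower.toAlgHom O R B) : Witt π n R →+* Witt π n B))
    have hz : ∀ j, (0 : Witt π n R).coeff j = 0 := congrFun
      (ghost_injective π (FrobeniusBase.torsionFree (π := π)) (b := fun _ => 0) fun k hk => by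
        have := congrFun (ghostFun_zero (π := π) (n := n) (B := R)) ⟨k, Nat.lt_succ_of_le hk⟩
        refine this.trans ?_
        symm
        refine Finset.sum_eq_zero fun j _ => ?_
        rw [zero_pow (pow_pos (residueCard_pos π) _).ne', mul_zero, ite_self])
    refine h.symm.trans ?_
    change algebraMap R B ((0 : Witt π n R).coeff i) = 0
    rw [hz, map_zero]
  rw [h0]
  change algebraMap R B _ = 0
  obtain ⟨c, hc⟩ := key i i.2
  rw [Fin.eta, show N + n - i = N + (n - i) by omega, pow_add ϖ N (n - i)] at hc
  rw [hc, map_mul, map_mul, map_pow, hN, zero_mul, zero_mul]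

end Witt

/-! ### Sheaves and formal schemes on `Nilp_R` -/

/-- The category `Nilp_R`: objects are the `R`-algebras in which `π` is nilpotent. -/
structure NilpAlg {O : Type v} [CommRing O] (π : O) (R : Type u) [CommRing R] [Algebra O R] where
  carrier : Type u
  [commRing : CommRing carrier]
  [algebra : Algebra R carrier]
  isNilpotent : IsNilpotent (algebraMap R carrier (algebraMap O R π))

namespace NilpAlg

variable {O : Type v} [CommRing O] {π : O} {R : Type u} [CommRing R] [Algebra O R]

instance : CoeSort (NilpAlg π R) (Type u) := ⟨carrier⟩

attribute [instance] commRing algebra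

instance : Category (NilpAlg π R) where
  Hom B C := B →ₐ[R] C
  id B := AlgHom.id R B
  comp f g := AlgHom.comp g f

/-- A morphism in `Nilp_R`, as a homomorphism of `R`-algebras. -/
abbrev toAlgHom {B C : NilpAlg π R} (g : B ⟶ C) : B →ₐ[R] C := g

/-- The `O`-algebra structure of an `R`-algebra. -/
instance (B : NilpAlg π R) : Algebra O B := Algebra.compHom B (algebraMap O R)

instance (B : NilpAlg π R) : IsScalarTower O R B := IsScalarTower.of_algebraMap_eq fun _ => rfl

/-- The localization `B_f`. -/
noncomputable abbrev away (B : NilpAlg π R) (f : B) : NilpAlg π R where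
  carrier := Localization.Away f
  isNilpotent := by
    rw [IsScalarTower.algebraMap_apply R B (Localization.Away f)]
    exact B.isNilpotent.map _

/-- The localization map `B → B_f`. -/
noncomputable def toAway (B : NilpAlg π R) (f : B) : B ⟶ B.away f :=
  IsScalarTower.toAlgHom R B (Localization.Away f)

end NilpAlg

section FormalSchemes

variable {O : Type v} [CommRing O] {π : O} {R : Type u} [CommRing R] [Algebra O R]

/-- Sheaves of sets for the Zariski topology on the opposite category of `Nilp_R`: if `f₁, …, fₘ`
generate the unit ideal of `B`, sections over the `B_{fᵢ}` that agree on overlaps glue uniquely. -/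
def IsZariskiSheaf (X : NilpAlg π R ⥤ Type u) : Prop :=
  ∀ (B : NilpAlg π R) (m : ℕ) (f : Fin m → B), Ideal.span (Set.range f) = ⊤ →
    ∀ s : ∀ i, X.obj (B.away (f i)),
      (∀ (i j : Fin m) (C : NilpAlg π R) (g : B.away (f i) ⟶ C) (h : B.away (f j) ⟶ C),
        B.toAway (f i) ≫ g = B.toAway (f j) ≫ h → X.map g (s i) = X.map h (s j)) →
      ∃! t : X.obj B, ∀ i, X.map (B.toAway (f i)) t = s i

variable (π) in
/-- The functor `Spf(A)` on `Nilp_R` for the `I`-adic topology on `A`: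
`Spf(A)(B) = colim_m Hom_R(A ⧸ I ^ m, B)`, i.e. the set of `R`-algebra homomorphisms `A → B`
that kill some power of `I`. -/
def Spf {A : Type u} [CommRing A] [Algebra R A] (I : Ideal A) : NilpAlg π R ⥤ Type u where
  obj B := {f : A →ₐ[R] B // ∃ m : ℕ, I ^ m ≤ RingHom.ker f}
  map {B C} g := TypeCat.ofHom fun f => ⟨AlgHom.comp g f.1, by
    obtain ⟨m, hm⟩ := f.2
    exact ⟨m, fun a ha => by
      have h : f.1 a = 0 := hm ha
      rw [RingHom.mem_ker, AlgHom.comp_apply, h, map_zero]⟩⟩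

/-- The morphism `Spf(A') → Spf(A)` induced by `f : A → A'` with `f(I) ⊆ I'`. -/
def Spf.map {A A' : Type u} [CommRing A] [Algebra R A] [CommRing A'] [Algebra R A']
    {I : Ideal A} {I' : Ideal A'} (f : A →ₐ[R] A') (hf : I ≤ I'.comap f) :
    Spf π (R := R) I' ⟶ Spf π (R := R) I where
  app B := TypeCat.ofHom fun g => ⟨g.1.comp f, by
    obtain ⟨m, hm⟩ := g.2
    refine ⟨m, fun a ha => ?_⟩
    have h : f a ∈ I' ^ m := (Ideal.pow_right_mono hf m).trans (Ideal.le_comap_pow _ m) ha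
    exact hm h⟩

/-- `U ⟶ X` is an open subfunctor: it is injective, and for every `b ∈ X(B)` the subfunctor
`U ×_X Spec(B)` of `Spec(B)` is the open subscheme complementary to some ideal `J` of `B`. -/
def IsOpenImmersion {U X : NilpAlg π R ⥤ Type u} (j : U ⟶ X) : Prop :=
  (∀ B : NilpAlg π R, Function.Injective (j.app B)) ∧
  ∀ (B : NilpAlg π R) (b : X.obj B), ∃ J : Ideal B, ∀ (C : NilpAlg π R) (g : B ⟶ C),
    X.map g b ∈ Set.range (j.app C) ↔ J.map (NilpAlg.toAlgHom g) = ⊤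

/-- An open cover: open subfunctors such that every section of `X` lies Zariski-locally in one
of them. -/
def IsOpenCover {X : NilpAlg π R ⥤ Type u} {ι : Type u} {U : ι → NilpAlg π R ⥤ Type u}
    (j : ∀ i, U i ⟶ X) : Prop :=
  (∀ i, IsOpenImmersion (j i)) ∧
  ∀ (B : NilpAlg π R) (b : X.obj B), Ideal.span {f : B | ∃ i,
    X.map (B.toAway f) b ∈ Set.range ((j i).app (B.away f))} = ⊤

variable (π R) in
/-- An adic `R`-algebra with an ideal of definition containing `π`. -/
structure AdicAlg where
  carrier : Type u
  [commRing : CommRing carrier]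
  [algebra : Algebra R carrier]
  I : Ideal carrier
  complete : IsAdicComplete I carrier
  mem : algebraMap R carrier (algebraMap O R π) ∈ I

attribute [instance] AdicAlg.commRing AdicAlg.algebra

/-- A formal scheme over `R`: a sheaf on `Nilp_R` with an open cover by functors `Spf(A)`. -/
def IsFormalScheme (X : NilpAlg π R ⥤ Type u) : Prop :=
  IsZariskiSheaf X ∧ ∃ (ι : Type u) (A : ι → AdicAlg π R) (j : ∀ i, Spf π (A i).I ⟶ X),
    IsOpenCover j

/-- `Spf(A)` is smooth over `R`: `A` carries the `π`-adic topology and each `A ⧸ π ^ m` is a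
smooth algebra over `R ⧸ π ^ m`. -/
def AdicAlg.IsSmooth (A : AdicAlg π R) : Prop :=
  A.I = Ideal.span {algebraMap R A.carrier (algebraMap O R π)} ∧
  ∀ m : ℕ, Algebra.Smooth (R ⧸ Ideal.span {algebraMap O R π} ^ m)
    (TensorProduct R (R ⧸ Ideal.span {algebraMap O R π} ^ m) A.carrier)

/-- A smooth formal scheme over `R`: a formal scheme with an open cover by smooth `Spf(A)`. -/
def IsSmoothFormalScheme (X : NilpAlg π R ⥤ Type u) : Prop :=
  IsFormalScheme X ∧ ∃ (ι : Type u) (A : ι → AdicAlg π R) (j : ∀ i, Spf π (A i).I ⟶ X),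
    (∀ i, (A i).IsSmooth) ∧ IsOpenCover j

variable (π R) in
/-- The ideal `π A` of an `R`-algebra `A`. -/
def piIdeal (A : Type u) [CommRing A] [Algebra R A] : Ideal A :=
  Ideal.span {algebraMap R A (algebraMap O R π)}

variable (π R) in
/-- `Spf(A)` for the `π`-adic topology on the `R`-algebra `A`. -/
abbrev piSpf (A : Type u) [CommRing A] [Algebra R A] : NilpAlg π R ⥤ Type u :=
  Spf π (piIdeal π R A)

/-- The morphism `Spf(A') → Spf(A)` induced by an `R`-algebra homomorphism, for the `π`-adic
topologies. -/
def piSpfMap {A A' : Type u} [CommRing A] [Algebra R A] [CommRing A'] [Algebra R A']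
    (f : A →ₐ[R] A') : piSpf π R A' ⟶ piSpf π R A :=
  Spf.map f (by
    rw [piIdeal, Ideal.span_singleton_le_iff_mem, Ideal.mem_comap, AlgHom.commutes]
    exact Ideal.mem_span_singleton_self _)

/-- An `R`-algebra homomorphism `A → B` with `B` in `Nilp_R`, as a `B`-point of `Spf(A)`. -/
def piSpfPoint {A : Type u} [CommRing A] [Algebra R A] {B : NilpAlg π R} (f : A →ₐ[R] B) :
    (piSpf π R A).obj B :=
  ⟨f, by
    obtain ⟨m, hm⟩ := B.isNilpotent
    refine ⟨m, ?_⟩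
    rw [piIdeal, Ideal.span_singleton_pow, Ideal.span_singleton_le_iff_mem, RingHom.mem_ker,
      map_pow, AlgHom.commutes, hm]⟩

end FormalSchemes

/-! ### Jets, shifted Witt vectors and the fibre of the jet functor -/

section Jets

variable {O : Type v} [CommRing O] [IsDomain O] {π : O} [IsUniformizer π]
variable {R : Type u} [CommRing R] [Algebra O R] [FrobeniusBase π R]

/-- `W_n(B)` as an object of `Nilp_R`. -/
noncomputable abbrev NilpAlg.witt (n : ℕ) (B : NilpAlg π R) : NilpAlg π R where
  carrier := Witt π n B
  isNilpotent := Witt.isNilpotent B.isNilpotent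

variable (π R) in
/-- The functor `W_n` on `Nilp_R`. -/
noncomputable def wittFunctor (n : ℕ) : NilpAlg π R ⥤ NilpAlg π R where
  obj B := B.witt n
  map f := Witt.mapₐ f

variable (π R) in
/-- The natural projection `w₀ : W_n(B) → B`. -/
noncomputable def wittProj (n : ℕ) : wittFunctor π R n ⟶ 𝟭 (NilpAlg π R) where
  app B := Witt.w₀ π R n B

/-- The `n`-th `π`-jet functor, `J^n X (C) = X (W_n(C))`. -/
noncomputable def jet (n : ℕ) (X : NilpAlg π R ⥤ Type u) : NilpAlg π R ⥤ Type u :=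
  wittFunctor π R n ⋙ X

/-- The natural morphism `u : J^n X → X`, given by `X(w₀)`. -/
noncomputable def jetProj (n : ℕ) (X : NilpAlg π R ⥤ Type u) : jet n X ⟶ X where
  app B := X.map ((wittProj π R n).app B)
  naturality B C f := by
    change X.map ((wittFunctor π R n).map f) ≫ X.map ((wittProj π R n).app C) =
      X.map ((wittProj π R n).app B) ≫ X.map f
    rw [← X.map_comp, ← X.map_comp]
    exact congrArg X.map ((wittProj π R n).naturality f)

variable {X : NilpAlg π R ⥤ Type u}

/-- The value `x_B ∈ X(B)` of a marked point `x : Spf(R) → X`. -/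
def pointAt (x : piSpf π R R ⟶ X) (B : NilpAlg π R) : X.obj B :=
  x.app B (piSpfPoint (Algebra.ofId R B))

theorem map_pointAt (x : piSpf π R R ⟶ X) {B C : NilpAlg π R} (g : B ⟶ C) :
    X.map g (pointAt x B) = pointAt x C := by
  have h := congrArg (fun t => t (piSpfPoint (Algebra.ofId R B))) (x.naturality g)
  refine h.symm.trans (congrArg (x.app C) (Subtype.ext (AlgHom.ext fun r => ?_)))
  exact AlgHom.commutes (NilpAlg.toAlgHom g) r

/-- The fibre `N^n X = J^n X ×_X Spf(R)` of `u : J^n X → X` at the marked point `x`. -/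
noncomputable def jetFibre (n : ℕ) (x : piSpf π R R ⟶ X) : NilpAlg π R ⥤ Type u where
  obj B := {y : (jet n X).obj B // (jetProj n X).app B y = pointAt x B}
  map {B C} g := TypeCat.ofHom fun y => ⟨(jet n X).map g y.1, by
    have h := congrArg (fun t => t y.1) ((jetProj n X).naturality g)
    exact h.trans ((congrArg (X.map g) y.2).trans (map_pointAt x g))⟩
  map_id B := by
    refine ConcreteCategory.hom_ext _ _ fun y => Subtype.ext ?_
    exact congrArg (fun t => t y.1) ((jet n X).map_id B)
  map_comp f g := by
    refine ConcreteCategory.hom_ext _ _ fun y => Subtype.ext ?_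
    exact congrArg (fun t => t y.1) ((jet n X).map_comp f g)

/-- The shifted Witt vectors `W_n⁺(B) = R ×_B W_n(B)`, an `R`-algebra. -/
noncomputable def ShiftedWitt (n : ℕ) (B : NilpAlg π R) : Subalgebra R (R × Witt π n B) :=
  AlgHom.equalizer ((Algebra.ofId R B).comp (AlgHom.fst R R (Witt π n B)))
    ((Witt.w₀ π R n B).comp (AlgHom.snd R R (Witt π n B)))

namespace ShiftedWitt

variable (n : ℕ) (B : NilpAlg π R)

/-- The augmentation `w₀⁺ : W_n⁺(B) → R`. -/
noncomputable def augmentation : ShiftedWitt n B →ₐ[R] R :=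
  (AlgHom.fst R R (Witt π n B)).comp (ShiftedWitt n B).val

/-- The projection `W_n⁺(B) → W_n(B)`. -/
noncomputable def toWitt : ShiftedWitt n B →ₐ[R] B.witt n :=
  (AlgHom.snd R R (Witt π n B)).comp (ShiftedWitt n B).val

theorem w₀_toWitt (a : ShiftedWitt n B) :
    Witt.w₀ π R n B (toWitt n B a) = algebraMap R B (augmentation n B a) := a.2.symm

/-- Functoriality of `W_n⁺`. -/
noncomputable def map {B C : NilpAlg π R} (g : B ⟶ C) : ShiftedWitt n B →ₐ[R] ShiftedWitt n C :=
  (((AlgHom.prodMap (AlgHom.id R R) (Witt.mapₐ (π := π) (n := n) g)).comp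
    (ShiftedWitt n B).val)).codRestrict _ fun a =>
      ((NilpAlg.toAlgHom g).commutes a.1.1).symm.trans
        (congrArg (NilpAlg.toAlgHom g) (show algebraMap R B a.1.1 = a.1.2.coeff 0 from a.2))

end ShiftedWitt

/-- The set of morphisms `Spf(W_n⁺(B)) → X` of `R`-pointed formal schemes, where `Spf(W_n⁺(B))`
is pointed by the augmentation `w₀⁺` and `X` by `x`. -/
def PointedHom (n : ℕ) (x : piSpf π R R ⟶ X) (B : NilpAlg π R) :=
  {f : piSpf π R (ShiftedWitt n B) ⟶ X // piSpfMap (ShiftedWitt.augmentation n B) ≫ f = x}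

/-- Functoriality of `PointedHom` in `B`: composition with `Spf(W_n⁺(C)) → Spf(W_n⁺(B))`. -/
noncomputable def PointedHom.map {n : ℕ} {x : piSpf π R R ⟶ X} {B C : NilpAlg π R} (g : B ⟶ C)
    (f : PointedHom n x B) : PointedHom n x C :=
  ⟨piSpfMap (ShiftedWitt.map n g) ≫ f.1, by
    exact (Category.assoc _ _ _).symm.trans f.2⟩

/-- The canonical map from pointed morphisms `f : Spf(W_n⁺(B)) → X` to `N^n X (B)`: the
composite `Spec(W_n(B)) → Spf(W_n⁺(B)) → X` is a point of `X(W_n(B)) = J^n X (B)`. -/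
noncomputable def PointedHom.toJetFibre {n : ℕ} {x : piSpf π R R ⟶ X} {B : NilpAlg π R}
    (f : PointedHom n x B) : (jetFibre n x).obj B :=
  ⟨f.1.app (B.witt n) (piSpfPoint (ShiftedWitt.toWitt n B)), by
    have h := congrArg (fun t => t (piSpfPoint (ShiftedWitt.toWitt n B)))
      (f.1.naturality ((wittProj π R n).app B))
    refine h.symm.trans ?_
    have h2 := congrArg (fun t : piSpf π R R ⟶ X => t.app B (piSpfPoint (Algebra.ofId R B))) f.2
    refine Eq.trans (congrArg (f.1.app B) (Subtype.ext (AlgHom.ext fun a => ?_))) h2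
    exact ShiftedWitt.w₀_toWitt n B a⟩

end Jets

/-! ### The ring of integers of a `p`-adic field -/

/-- The ring of integers of a finite extension `K` of `ℚ_p`. -/
noncomputable abbrev PadicIntegers (p : ℕ) [Fact p.Prime] (K : Type v) [Field K] [Algebra ℤ_[p] K] :=
  integralClosure ℤ_[p] K

instance (p : ℕ) [Fact p.Prime] (K : Type v) [Field K] [Algebra ℚ_[p] K] [Algebra ℤ_[p] K]
    [IsScalarTower ℤ_[p] ℚ_[p] K] [FiniteDimensional ℚ_[p] K] (π : PadicIntegers p K)
    [hπ : Fact (Prime π)] : IsUniformizer π where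
  prime := hπ.out
  finite := by
    have hfin : Module.Finite ℤ_[p] (PadicIntegers p K) :=
      IsIntegralClosure.finite ℤ_[p] ℚ_[p] K (PadicIntegers p K)
    have hP : (Ideal.span {π}).IsPrime := (Ideal.span_singleton_prime hπ.out.ne_zero).2 hπ.out
    have hm : (Ideal.span {π}).comap (algebraMap ℤ_[p] (PadicIntegers p K)) =
        IsLocalRing.maximalIdeal ℤ_[p] := by
      have h0 : (Ideal.span {π}).comap (algebraMap ℤ_[p] (PadicIntegers p K)) ≠ ⊥ :=
        Ideal.comap_ne_bot_of_integral_mem hπ.out.ne_zero (Ideal.mem_span_singleton_self π)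
          (Algebra.IsIntegral.isIntegral π)
      have hp : ((Ideal.span {π}).comap (algebraMap ℤ_[p] (PadicIntegers p K))).IsPrime :=
        hP.comap _
      exact IsLocalRing.eq_maximalIdeal (hp.isMaximal h0)
    have htor : Module.IsTorsionBySet ℤ_[p] (PadicIntegers p K ⧸ Ideal.span {π})
        (IsLocalRing.maximalIdeal ℤ_[p]) := by
      rintro y ⟨a, ha⟩
      change a • y = 0
      obtain ⟨y, rfl⟩ := Ideal.Quotient.mk_surjective y
      rw [SetLike.mem_coe, ← hm, Ideal.mem_comap] at ha
      rw [← Ideal.Quotient.mkₐ_eq_mk ℤ_[p], ← map_smul, Algebra.smul_def,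
        Ideal.Quotient.mkₐ_eq_mk, map_mul, Ideal.Quotient.eq_zero_iff_mem.2 ha, zero_mul]
    let := htor.module
    have := htor.isScalarTower (S := ℤ_[p])
    have : Finite (ℤ_[p] ⧸ IsLocalRing.maximalIdeal ℤ_[p]) :=
      Finite.of_equiv _ (PadicInt.residueField (p := p)).symm.toEquiv
    have : Module.Finite (ℤ_[p] ⧸ IsLocalRing.maximalIdeal ℤ_[p])
        (PadicIntegers p K ⧸ Ideal.span {π}) :=
      Module.Finite.of_restrictScalars_finite ℤ_[p] _ _
    exact Module.finite_of_finite (ℤ_[p] ⧸ IsLocalRing.maximalIdeal ℤ_[p])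

end PiJet

open PiJet

universe u v

/-!
The projection `w₀ : W_n(B) → B` is surjective with nil kernel. If `W → B` is such a nil thickening
and `E = S ×_B W`, then `E → S` is one too, so `Spec E` and `Spec S` have the same open subsets, and
a cover of a formal scheme `X` by functors `Spf(A)` that trivialises a point of `X(S)` also
trivialises every point of `X(E)` above it. Since each `Spf(A)` takes `E` to a fibre product, gluing
gives `X(E) = X(S) ×_{X(B)} X(W)`. Now `W_n⁺(B)` is the limit over `k` of the rings
`R/π^k ×_B W_n(B)`, so a morphism `Spf(W_n⁺(B)) → X` is a morphism `Spf(R) → X` together with a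
point of `X(W_n(B))` having the same image in `X(B)`; being pointed means that the first one is `x`.
-/

namespace PiJet

section FibreSquares

/-- A square of maps that identifies `E` with the fibre product `S ×_B W` as a set. It is used both
for the underlying maps of ring homomorphisms and for the sections of a sheaf. -/
structure IsFibreSquare {E S W B : Type*} (p : E → S) (q : E → W) (s : S → B) (w : W → B) :
    Prop where
  comm : ∀ e, s (p e) = w (q e)
  ext : ∀ {e e'}, p e = p e' → q e = q e' → e = e'
  exists_eq : ∀ {a b}, s a = w b → ∃ e, p e = a ∧ q e = b

/-- A surjection of commutative rings whose kernel is a nil ideal. -/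
structure IsNilThickening {C D : Type*} [CommRing C] [CommRing D] (g : C →+* D) : Prop where
  surjective : Function.Surjective g
  ker_le : RingHom.ker g ≤ nilradical C

namespace IsNilThickening

variable {C D : Type*} [CommRing C] [CommRing D] {g : C →+* D}

theorem eq_top_of_map_eq_top (hg : IsNilThickening g) {J : Ideal C} (h : J.map g = ⊤) :
    J = ⊤ := by
  rw [Ideal.eq_top_iff_one, Ideal.mem_map_iff_of_surjective _ hg.surjective] at h
  obtain ⟨a, ha, ha_one⟩ := h
  have hnil : IsNilpotent (1 - a) := hg.ker_le (by rw [RingHom.mem_ker, map_sub, map_one, ha_one,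
    sub_self])
  exact J.eq_top_of_isUnit_mem ha (sub_sub_cancel 1 a ▸ hnil.isUnit_one_sub)

theorem localization (hg : IsNilThickening g) (M : Submonoid C) {C' D' : Type*} [CommRing C']
    [CommRing D'] [Algebra C C'] [Algebra D D'] [IsLocalization M C']
    [IsLocalization (M.map g) D'] {g' : C' →+* D'}
    (h : ∀ x, g' (algebraMap C C' x) = algebraMap D D' (g x)) : IsNilThickening g' := by
  obtain rfl := IsLocalization.map_unique M.le_comap_map g' h
  refine ⟨IsLocalization.map_surjective_of_surjective M C' D' hg.surjective, ?_⟩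
  rw [IsLocalization.ker_map D' g rfl, Ideal.map_le_iff_le_comap]
  exact fun c hc => IsNilpotent.map (hg.ker_le hc) (algebraMap C C')

end IsNilThickening

theorem map_mk'_eq {C D C' D' : Type*} [CommRing C] [CommRing D] [CommRing C'] [CommRing D']
    [Algebra C C'] [Algebra D D'] (M : Submonoid C) {g : C →+* D} [IsLocalization M C']
    [IsLocalization (M.map g) D'] {g' : C' →+* D'}
    (h : ∀ x, g' (algebraMap C C' x) = algebraMap D D' (g x)) {c : C} {m : M} {y : D'}
    (hy : y * algebraMap D D' (g m) = algebraMap D D' (g c)) :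
    g' (IsLocalization.mk' C' c m) = y := by
  have hm : IsUnit (algebraMap D D' (g m)) :=
    IsLocalization.map_units D' (⟨g m, m, m.2, rfl⟩ : M.map g)
  refine hm.mul_right_cancel ?_
  rw [hy, ← h, ← map_mul, IsLocalization.mk'_spec, h]

theorem smodEq_span_singleton_pow_iff {A : Type*} [CommRing A] {t a b : A} {k : ℕ} :
    a ≡ b [SMOD (Ideal.span {t} ^ k • ⊤ : Submodule A A)] ↔ t ^ k ∣ a - b := by
  rw [SModEq.sub_mem, smul_eq_mul, Ideal.mul_top, Ideal.span_singleton_pow,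
    Ideal.mem_span_singleton]

namespace IsFibreSquare

variable {E S W B : Type*} [CommRing E] [CommRing S] [CommRing W] [CommRing B]
variable {p : E →+* S} {q : E →+* W} {s : S →+* B} {w : W →+* B}

theorem eq_zero (H : IsFibreSquare p q s w) {e : E} (hp : p e = 0) (hq : q e = 0) : e = 0 :=
  H.ext (hp.trans (map_zero p).symm) (hq.trans (map_zero q).symm)

theorem isNilThickening_fst (H : IsFibreSquare p q s w) (hw : IsNilThickening w) :
    IsNilThickening p where
  surjective a := by
    obtain ⟨b, hb⟩ := hw.surjective (s a)
    obtain ⟨e, he, -⟩ := H.exists_eq hb.symm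
    exact ⟨e, he⟩
  ker_le e he := by
    rw [RingHom.mem_ker] at he
    have hqe : w (q e) = 0 := by rw [← H.comm, he, map_zero]
    obtain ⟨n, hn⟩ := hw.ker_le hqe
    refine ⟨n + 1, H.eq_zero ?_ ?_⟩
    · rw [map_pow, he, zero_pow n.succ_ne_zero]
    · rw [map_pow, pow_succ, hn, zero_mul]

section Localization

variable (M : Submonoid E) {E' S' W' B' : Type*}
variable [CommRing E'] [CommRing S'] [CommRing W'] [CommRing B']
variable [Algebra E E'] [Algebra S S'] [Algebra W W'] [Algebra B B']
variable {p' : E' →+* S'} {q' : E' →+* W'} {s' : S' →+* B'} {w' : W' →+* B'}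

theorem localization_eq_zero (H : IsFibreSquare p q s w) [IsLocalization M E']
    [IsLocalization (M.map p) S'] [IsLocalization (M.map q) W']
    (hp : ∀ x, p' (algebraMap E E' x) = algebraMap S S' (p x))
    (hq : ∀ x, q' (algebraMap E E' x) = algebraMap W W' (q x))
    {z : E'} (hpz : p' z = 0) (hqz : q' z = 0) : z = 0 := by
  obtain ⟨x, m, rfl⟩ := IsLocalization.exists_mk'_eq M z
  have hx := IsLocalization.mk'_spec E' x m
  have hpx : algebraMap S S' (p x) = 0 := by rw [← hp, ← hx, map_mul, hpz, zero_mul]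
  have hqx : algebraMap W W' (q x) = 0 := by rw [← hq, ← hx, map_mul, hqz, zero_mul]
  obtain ⟨⟨_, a, ha, rfl⟩, hpa⟩ := (IsLocalization.map_eq_zero_iff (M.map p) S' _).1 hpx
  obtain ⟨⟨_, b, hb, rfl⟩, hqb⟩ := (IsLocalization.map_eq_zero_iff (M.map q) W' _).1 hqx
  rw [IsLocalization.mk'_eq_zero_iff]
  refine ⟨⟨a * b, mul_mem ha hb⟩, H.eq_zero ?_ ?_⟩
  · rw [map_mul, map_mul, mul_right_comm, hpa, zero_mul]
  · rw [map_mul, map_mul, mul_assoc, hqb, mul_zero]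

theorem localization_exists_eq (H : IsFibreSquare p q s w) [IsLocalization M E']
    [IsLocalization (M.map p) S'] [IsLocalization (M.map q) W']
    [IsLocalization (M.map (s.comp p)) B']
    (hp : ∀ x, p' (algebraMap E E' x) = algebraMap S S' (p x))
    (hq : ∀ x, q' (algebraMap E E' x) = algebraMap W W' (q x))
    (hs : ∀ x, s' (algebraMap S S' x) = algebraMap B B' (s x))
    (hw : ∀ x, w' (algebraMap W W' x) = algebraMap B B' (w x))
    {y : S'} {z : W'} (hyz : s' y = w' z) : ∃ e, p' e = y ∧ q' e = z := by
  obtain ⟨⟨a, _, m, hm, rfl⟩, ha⟩ := IsLocalization.surj (M.map p) y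
  obtain ⟨⟨b, _, n, hn, rfl⟩, hb⟩ := IsLocalization.surj (M.map q) z
  dsimp only at ha hb
  have hab : algebraMap B B' (s (p n * a)) = algebraMap B B' (w (q m * b)) := by
    rw [← hs, ← hw, map_mul, map_mul (algebraMap W W'), ← ha, ← hb]
    simp only [map_mul, hs, hw, H.comm, hyz]
    ring
  obtain ⟨⟨_, k, hk, rfl⟩, hkab⟩ := (IsLocalization.eq_iff_exists (M.map (s.comp p)) B').1 hab
  obtain ⟨e, hpe, hqe⟩ := H.exists_eq (a := p k * (p n * a)) (b := q k * (q m * b)) (by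
    rw [map_mul, map_mul w, ← H.comm]
    exact hkab)
  let d : M := ⟨k * (m * n), mul_mem hk (mul_mem hm hn)⟩
  refine ⟨IsLocalization.mk' E' e d, map_mk'_eq M hp ?_, map_mk'_eq M hq ?_⟩
  · simp only [d, hpe, map_mul, ← ha]
    ring
  · simp only [d, hqe, map_mul, ← hb]
    ring

theorem localization (H : IsFibreSquare p q s w) [IsLocalization M E']
    [IsLocalization (M.map p) S'] [IsLocalization (M.map q) W']
    [IsLocalization (M.map (s.comp p)) B']
    (hp : ∀ x, p' (algebraMap E E' x) = algebraMap S S' (p x))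
    (hq : ∀ x, q' (algebraMap E E' x) = algebraMap W W' (q x))
    (hs : ∀ x, s' (algebraMap S S' x) = algebraMap B B' (s x))
    (hw : ∀ x, w' (algebraMap W W' x) = algebraMap B B' (w x)) :
    IsFibreSquare p' q' s' w' where
  comm := RingHom.congr_fun (f := s'.comp p') (g := w'.comp q') <|
    IsLocalization.ringHom_ext M <| RingHom.ext fun x => by
      simp only [RingHom.comp_apply, hp, hq, hs, hw, H.comm]
  ext h₁ h₂ := sub_eq_zero.1 <| H.localization_eq_zero M hp hq
    (by rw [map_sub, h₁, sub_self]) (by rw [map_sub, h₂, sub_self])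
  exists_eq := H.localization_exists_eq M hp hq hs hw

end Localization

theorem pow_dvd (H : IsFibreSquare p q s w) {t e : E} {N k : ℕ} (hN : s (p t) ^ N = 0)
    (hp : p t ^ (N + k) ∣ p e) (hq : q e = 0) : t ^ k ∣ e := by
  obtain ⟨d, hd⟩ := hp
  obtain ⟨c, hpc, hqc⟩ := H.exists_eq (a := p t ^ N * d) (b := 0) (by
    rw [map_mul, map_pow, hN, zero_mul, map_zero])
  refine ⟨c, H.ext ?_ ?_⟩
  · rw [hd, map_mul, map_pow, hpc, pow_add]
    ring
  · rw [hq, map_mul, hqc, mul_zero]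

theorem isAdicComplete (H : IsFibreSquare p q s w) (t : E)
    [hS : IsAdicComplete (Ideal.span {p t}) S] (ht : IsNilpotent (q t)) :
    IsAdicComplete (Ideal.span {t}) E := by
  obtain ⟨N, hN⟩ := ht
  have hsN : s (p t) ^ N = 0 := by rw [H.comm, ← map_pow, hN, map_zero]
  have q_eq_zero {k : ℕ} {e : E} (hk : N ≤ k) (he : t ^ k ∣ e) : q e = 0 := by
    obtain ⟨c, rfl⟩ := he
    rw [map_mul, map_pow, pow_eq_zero_of_le hk hN, zero_mul]
  have p_dvd {k : ℕ} {e : E} (he : t ^ k ∣ e) : p t ^ k ∣ p e := map_pow p t k ▸ map_dvd p he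
  refine { haus' := fun e he => ?_, prec' := fun f hf => ?_ }
  · simp only [smodEq_span_singleton_pow_iff, sub_zero] at he
    refine H.eq_zero (hS.haus' _ fun k => ?_) (q_eq_zero le_rfl (he N))
    rw [smodEq_span_singleton_pow_iff, sub_zero]
    exact p_dvd (he k)
  · simp only [smodEq_span_singleton_pow_iff] at hf ⊢
    obtain ⟨a, ha⟩ := hS.prec' (fun k => p (f k)) fun {k l} hkl => by
      rw [smodEq_span_singleton_pow_iff, ← map_sub]
      exact p_dvd (hf hkl)
    simp only [smodEq_span_singleton_pow_iff] at ha
    obtain ⟨e, rfl, hqe⟩ : ∃ e, p e = a ∧ q e = q (f N) := H.exists_eq <| by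
      obtain ⟨d, hd⟩ := ha N
      rw [← H.comm, eq_comm, ← sub_eq_zero, ← map_sub, hd, map_mul, map_pow, hsN, zero_mul]
    refine ⟨e, fun k => ?_⟩
    have near_e : t ^ k ∣ f (N + k) - e := by
      refine H.pow_dvd hsN (by rw [map_sub]; exact ha (N + k)) ?_
      rw [map_sub, hqe, ← map_sub, ← neg_sub, map_neg, q_eq_zero le_rfl (hf (N.le_add_right k)),
        neg_zero]
    exact sub_add_sub_cancel (f k) (f (N + k)) e ▸ dvd_add (hf (Nat.le_add_left k N)) near_e

theorem exists_algHom {k A E S W B : Type*} [CommRing k] [CommRing A] [CommRing E] [CommRing S]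
    [CommRing W] [Algebra k A] [Algebra k E] [Algebra k S] [Algebra k W]
    {p : E →ₐ[k] S} {q : E →ₐ[k] W} {s : S → B} {w : W → B} (H : IsFibreSquare p q s w)
    (a : A →ₐ[k] S) (b : A →ₐ[k] W) (hab : ∀ x, s (a x) = w (b x)) :
    ∃ e : A →ₐ[k] E, p.comp e = a ∧ q.comp e = b := by
  choose e hpe hqe using fun x => H.exists_eq (hab x)
  let φ : A →ₐ[k] E :=
    { toFun := e
      map_one' := H.ext (by simp only [hpe, map_one]) (by simp only [hqe, map_one])
      map_zero' := H.ext (by simp only [hpe, map_zero]) (by simp only [hqe, map_zero])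
      map_add' x y := H.ext (by simp only [hpe, map_add]) (by simp only [hqe, map_add])
      map_mul' x y := H.ext (by simp only [hpe, map_mul]) (by simp only [hqe, map_mul])
      commutes' r := H.ext (by simp only [hpe, AlgHom.commutes])
        (by simp only [hqe, AlgHom.commutes]) }
  exact ⟨φ, AlgHom.ext hpe, AlgHom.ext hqe⟩

end IsFibreSquare

end FibreSquares

section Localization

variable {O : Type v} [CommRing O] {π : O} {R : Type u} [CommRing R] [Algebra O R]

namespace NilpAlg

theorem isUnit_toAway (B : NilpAlg π R) (f : B) : IsUnit (toAlgHom (B.toAway f) f) :=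
  IsLocalization.Away.algebraMap_isUnit f

theorem away_hom_ext {B C : NilpAlg π R} {f : B} {g h : B.away f ⟶ C}
    (e : B.toAway f ≫ g = B.toAway f ≫ h) : g = h :=
  IsLocalization.algHom_ext (Submonoid.powers f) e

/-- The universal property of the localization `B_f`. -/
noncomputable def awayLift {B C : NilpAlg π R} (g : B ⟶ C) {f : B} (hf : IsUnit (toAlgHom g f)) :
    B.away f ⟶ C :=
  IsLocalization.Away.liftAlgHom (S := Localization.Away f) f hf

theorem toAway_awayLift {B C : NilpAlg π R} (g : B ⟶ C) {f : B} (hf : IsUnit (toAlgHom g f)) :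
    B.toAway f ≫ awayLift g hf = g :=
  AlgHom.ext fun b => IsLocalization.Away.lift_eq f hf b

/-- The homomorphism `B_f → C_{f'}` induced by `g : B → C` with `g f = f'`. The element `f'` is kept
as a variable because the two composites of a commutative square send `f` to elements that are only
propositionally equal. -/
noncomputable def awayMap {B C : NilpAlg π R} (g : B ⟶ C) {f : B} {f' : C}
    (h : toAlgHom g f = f') : B.away f ⟶ C.away f' :=
  awayLift (g ≫ C.toAway f') (f := f) (h ▸ isUnit_toAway C f')

theorem toAway_awayMap {B C : NilpAlg π R} (g : B ⟶ C) {f : B} {f' : C}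
    (h : toAlgHom g f = f') : B.toAway f ≫ awayMap g h = g ≫ C.toAway f' :=
  toAway_awayLift _ _

theorem awayMap_algebraMap {B C : NilpAlg π R} (g : B ⟶ C) {f : B} {f' : C}
    (h : toAlgHom g f = f') (b : B) : toAlgHom (awayMap g h) (algebraMap B (B.away f) b) =
      algebraMap C (C.away f') (toAlgHom g b) :=
  DFunLike.congr_fun (F := B →ₐ[R] C.away f') (toAway_awayMap g h) b

theorem isLocalization_map_powers {B C : NilpAlg π R} (g : B ⟶ C) {f : B} {f' : C}
    (h : toAlgHom g f = f') :
    IsLocalization ((Submonoid.powers f).map (toAlgHom g : B →+* C)) (C.away f') := by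
  rw [Submonoid.map_powers, RingHom.coe_coe, h]
  infer_instance

end NilpAlg

open NilpAlg

theorem IsNilThickening.awayMap {C D : NilpAlg π R} {g : C ⟶ D}
    (hg : IsNilThickening (toAlgHom g : C →+* D)) {f : C} {f' : D} (h : toAlgHom g f = f') :
    IsNilThickening (toAlgHom (awayMap g h) : C.away f →+* D.away f') :=
  have := isLocalization_map_powers g h
  hg.localization (Submonoid.powers f) (awayMap_algebraMap g h)

variable {E S W B : NilpAlg π R} {p : E ⟶ S} {q : E ⟶ W} {s : S ⟶ B} {w : W ⟶ B}

theorem IsFibreSquare.awayMap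
    (H : IsFibreSquare (toAlgHom p) (toAlgHom q) (toAlgHom s) (toAlgHom w)) {e : E} {a : S} {b : W}
    {c : B} (hp : toAlgHom p e = a) (hq : toAlgHom q e = b) (hs : toAlgHom s a = c)
    (hw : toAlgHom w b = c) :
    IsFibreSquare (toAlgHom (NilpAlg.awayMap p hp)) (toAlgHom (NilpAlg.awayMap q hq))
      (toAlgHom (NilpAlg.awayMap s hs)) (toAlgHom (NilpAlg.awayMap w hw)) :=
  have := isLocalization_map_powers p hp
  have := isLocalization_map_powers q hq
  have : IsLocalization ((Submonoid.powers e).map ((toAlgHom s : S →+* B).comp (toAlgHom p)))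
      (B.away c) := isLocalization_map_powers (p ≫ s) ((congrArg (toAlgHom s) hp).trans hs)
  IsFibreSquare.localization (p := (toAlgHom p : E →+* S)) (q := (toAlgHom q : E →+* W))
    (s := (toAlgHom s : S →+* B)) (w := (toAlgHom w : W →+* B))
    (p' := (toAlgHom (NilpAlg.awayMap p hp) : E.away e →+* S.away a))
    (q' := (toAlgHom (NilpAlg.awayMap q hq) : E.away e →+* W.away b))
    (s' := (toAlgHom (NilpAlg.awayMap s hs) : S.away a →+* B.away c))
    (w' := (toAlgHom (NilpAlg.awayMap w hw) : W.away b →+* B.away c)) (Submonoid.powers e) H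
    (awayMap_algebraMap p hp) (awayMap_algebraMap q hq) (awayMap_algebraMap s hs)
    (awayMap_algebraMap w hw)

end Localization

section Sheaves

variable {O : Type v} [CommRing O] {π : O} {R : Type u} [CommRing R] [Algebra O R]
variable {X U : NilpAlg π R ⥤ Type u}

open NilpAlg

/-- Sections over two algebras under `B` that have the same image in every algebra under both. This
is the gluing condition of a Zariski sheaf, stated so that it is stable under restriction. -/
def AgreeOver (X : NilpAlg π R ⥤ Type u) {B C D : NilpAlg π R} (g : B ⟶ C) (h : B ⟶ D)
    (t : X.obj C) (t' : X.obj D) : Prop :=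
  ∀ ⦃K : NilpAlg π R⦄ (a : C ⟶ K) (b : D ⟶ K), g ≫ a = h ≫ b → X.map a t = X.map b t'

namespace AgreeOver

variable {B C D K : NilpAlg π R} {g : B ⟶ C} {h : B ⟶ D} {t : X.obj C} {t' : X.obj D}

theorem map_left (H : AgreeOver X g h t t') (k : C ⟶ K) : AgreeOver X (g ≫ k) h (X.map k t) t' :=
  fun _ a b e => by
    rw [← Functor.map_comp_apply]
    exact H _ _ (by rw [← Category.assoc, e])

theorem of_toAway {f : B} {t : X.obj (B.away f)}
    (H : X.map (awayMap h rfl) t = X.map (D.toAway (toAlgHom h f)) t') :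
    AgreeOver X (B.toAway f) h t t' := fun K a b e => by
  have hb : IsUnit (toAlgHom b (toAlgHom h f)) := by
    change IsUnit (toAlgHom (h ≫ b) f)
    rw [← e]
    exact (isUnit_toAway B f).map (toAlgHom a)
  have ha : awayMap h rfl ≫ awayLift b hb = a := away_hom_ext (by
    rw [← Category.assoc, toAway_awayMap, Category.assoc, toAway_awayLift, e])
  rw [← ha, Functor.map_comp_apply, H, ← Functor.map_comp_apply, toAway_awayLift]

theorem toAway_toAway {f g : B} {t : X.obj (B.away f)} {t' : X.obj (B.away g)}
    (H : ∀ (a : B.away f ⟶ B.away (f * g)) (b : B.away g ⟶ B.away (f * g)),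
      B.toAway f ≫ a = B.toAway (f * g) → B.toAway g ≫ b = B.toAway (f * g) →
      X.map a t = X.map b t') : AgreeOver X (B.toAway f) (B.toAway g) t t' := fun K a b e => by
  have hfg := isUnit_toAway B (f * g)
  rw [map_mul] at hfg
  have hf := isUnit_of_mul_isUnit_left hfg
  have hg := isUnit_of_mul_isUnit_right hfg
  have hK : IsUnit (toAlgHom (B.toAway f ≫ a) (f * g)) := by
    rw [map_mul]
    refine ((isUnit_toAway B f).map (toAlgHom a)).mul ?_
    rw [e]
    exact (isUnit_toAway B g).map (toAlgHom b)
  have ha : awayLift (B.toAway (f * g)) hf ≫ awayLift _ hK = a := away_hom_ext (by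
    rw [← Category.assoc, toAway_awayLift, toAway_awayLift])
  have hb : awayLift (B.toAway (f * g)) hg ≫ awayLift _ hK = b := away_hom_ext (by
    rw [← Category.assoc, toAway_awayLift, toAway_awayLift, e])
  rw [← ha, ← hb, Functor.map_comp_apply, Functor.map_comp_apply,
    H _ _ (toAway_awayLift _ hf) (toAway_awayLift _ hg)]

end AgreeOver

namespace IsZariskiSheaf

variable {B C : NilpAlg π R} {m : ℕ} {f : Fin m → B}

theorem exists_glue (hX : IsZariskiSheaf X) (hf : Ideal.span (Set.range f) = ⊤)
    (s : ∀ i, X.obj (B.away (f i)))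
    (hs : ∀ i j, AgreeOver X (B.toAway (f i)) (B.toAway (f j)) (s i) (s j)) :
    ∃ t : X.obj B, ∀ i, X.map (B.toAway (f i)) t = s i :=
  (hX B m f hf s fun i j _ g h => hs i j g h).exists

theorem ext (hX : IsZariskiSheaf X) (hf : Ideal.span (Set.range f) = ⊤) (g : B ⟶ C)
    {t t' : X.obj C}
    (h : ∀ i, X.map (C.toAway (toAlgHom g (f i))) t = X.map (C.toAway (toAlgHom g (f i))) t') :
    t = t' := by
  have hgf : Ideal.span (Set.range fun i => toAlgHom g (f i)) = ⊤ := by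
    rw [Set.range_comp' (toAlgHom g) f, ← Ideal.map_span, hf, Ideal.map_top]
  refine (hX C m _ hgf (fun i => X.map (C.toAway (toAlgHom g (f i))) t)
    fun i j K a b e => ?_).unique (fun _ => rfl) fun i => (h i).symm
  rw [← Functor.map_comp_apply, ← Functor.map_comp_apply, e]

end IsZariskiSheaf

theorem IsOpenImmersion.mem_range_of_map {j : U ⟶ X} (hj : IsOpenImmersion j) {C D : NilpAlg π R}
    {g : C ⟶ D} (hg : IsNilThickening (toAlgHom g : C →+* D)) {b : X.obj C}
    (h : X.map g b ∈ Set.range (j.app D)) : b ∈ Set.range (j.app C) := by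
  obtain ⟨J, hJ⟩ := hj.2 C b
  have hJ_top : J = ⊤ := hg.eq_top_of_map_eq_top ((hJ D g).1 h)
  have hb : X.map (𝟙 C) b ∈ Set.range (j.app C) := (hJ C (𝟙 C)).2 (by rw [hJ_top, Ideal.map_top])
  rwa [X.map_id_apply] at hb

variable {E S W B : NilpAlg π R} {p : E ⟶ S} {q : E ⟶ W} {s : S ⟶ B} {w : W ⟶ B}

theorem IsFibreSquare.spf (H : IsFibreSquare (toAlgHom p) (toAlgHom q) (toAlgHom s) (toAlgHom w))
    {A : Type u} [CommRing A] [Algebra R A] (I : Ideal A) :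
    IsFibreSquare ((Spf π I).map p) ((Spf π I).map q) ((Spf π I).map s) ((Spf π I).map w) where
  comm e := Subtype.ext (AlgHom.ext fun x => H.comm (e.1 x))
  ext h₁ h₂ := Subtype.ext (AlgHom.ext fun x =>
    H.ext (congrArg (fun t => t.1 x) h₁) (congrArg (fun t => t.1 x) h₂))
  exists_eq {a b} hab := by
    obtain ⟨e, hpe, hqe⟩ := H.exists_algHom a.1 b.1 fun x => congrArg (fun t => t.1 x) hab
    obtain ⟨k, hk⟩ := a.2
    obtain ⟨l, hl⟩ := b.2
    refine ⟨⟨e, k + l, fun x hx => H.ext ?_ ?_⟩, Subtype.ext hpe, Subtype.ext hqe⟩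
    · exact (AlgHom.congr_fun hpe x).trans
        ((hk (Ideal.pow_le_pow_right (Nat.le_add_right k l) hx)).trans (map_zero _).symm)
    · exact (AlgHom.congr_fun hqe x).trans
        ((hl (Ideal.pow_le_pow_right (Nat.le_add_left l k) hx)).trans (map_zero _).symm)

namespace IsOpenImmersion

variable {j : U ⟶ X}

theorem eq_of_isFibreSquare (hj : IsOpenImmersion j)
    (hU : IsFibreSquare (U.map p) (U.map q) (U.map s) (U.map w))
    (hp : IsNilThickening (toAlgHom p : E →+* S)) {t t' : X.obj E}
    (hmem : X.map p t ∈ Set.range (j.app S)) (h₁ : X.map p t = X.map p t')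
    (h₂ : X.map q t = X.map q t') : t = t' := by
  obtain ⟨e, rfl⟩ := hj.mem_range_of_map hp hmem
  obtain ⟨e', rfl⟩ := hj.mem_range_of_map hp (h₁ ▸ hmem)
  simp only [← NatTrans.naturality_apply] at h₁ h₂
  exact congrArg (j.app E) (hU.ext (hj.1 S h₁) (hj.1 W h₂))

theorem exists_of_isFibreSquare (hj : IsOpenImmersion j)
    (hU : IsFibreSquare (U.map p) (U.map q) (U.map s) (U.map w))
    (hw : IsNilThickening (toAlgHom w : W →+* B)) {a : X.obj S} {b : X.obj W}
    (hmem : a ∈ Set.range (j.app S)) (hab : X.map s a = X.map w b) :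
    ∃ t, X.map p t = a ∧ X.map q t = b := by
  obtain ⟨a, rfl⟩ := hmem
  rw [← NatTrans.naturality_apply] at hab
  obtain ⟨b, rfl⟩ := hj.mem_range_of_map hw ⟨_, hab⟩
  rw [← NatTrans.naturality_apply] at hab
  obtain ⟨e, rfl, rfl⟩ := hU.exists_eq (hj.1 B hab)
  exact ⟨j.app E e, (NatTrans.naturality_apply j p e).symm, (NatTrans.naturality_apply j q e).symm⟩

end IsOpenImmersion

theorem IsOpenCover.exists_finite {ι : Type u} {V : ι → NilpAlg π R ⥤ Type u} {j : ∀ i, V i ⟶ X}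
    (hj : IsOpenCover j) (hp : IsNilThickening (toAlgHom p : E →+* S)) (b : X.obj S) :
    ∃ (m : ℕ) (f : Fin m → E), Ideal.span (Set.range f) = ⊤ ∧
      ∀ k, ∃ i, X.map (S.toAway (toAlgHom p (f k))) b ∈ Set.range ((j i).app _) := by
  let T : Set S := {y | ∃ i, X.map (S.toAway y) b ∈ Set.range ((j i).app _)}
  have span_preimage : Ideal.span (toAlgHom p ⁻¹' T) = ⊤ := hp.eq_top_of_map_eq_top <| by
    rw [Ideal.map_span]
    exact (congrArg Ideal.span (Set.image_preimage_eq T hp.surjective)).trans (hj.2 S b)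
  obtain ⟨F, hF, hF_span⟩ := (Ideal.span_eq_top_iff_finite _).1 span_preimage
  obtain ⟨m, f, -, hf⟩ := F.finite_toSet.fin_param
  exact ⟨m, f, hf ▸ hF_span, fun k => hF (hf ▸ Set.mem_range_self k)⟩

end Sheaves

section FormalSchemeFibreSquare

open NilpAlg

variable {O : Type v} [CommRing O] {π : O} {R : Type u} [CommRing R] [Algebra O R]
variable {X : NilpAlg π R ⥤ Type u}

theorem NilpAlg.map_awayMap_map_toAway (X : NilpAlg π R ⥤ Type u) {B C : NilpAlg π R} (g : B ⟶ C)
    {f : B} {f' : C} (h : toAlgHom g f = f') (t : X.obj B) :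
    X.map (awayMap g h) (X.map (B.toAway f) t) = X.map (C.toAway f') (X.map g t) := by
  rw [← Functor.map_comp_apply, toAway_awayMap, Functor.map_comp_apply]

variable {E S W B : NilpAlg π R} {p : E ⟶ S} {q : E ⟶ W} {s : S ⟶ B} {w : W ⟶ B}

namespace IsFormalScheme

theorem eq_of_isFibreSquare (hX : IsFormalScheme X)
    (H : IsFibreSquare (toAlgHom p) (toAlgHom q) (toAlgHom s) (toAlgHom w))
    (hw : IsNilThickening (toAlgHom w : W →+* B)) {t t' : X.obj E} (h₁ : X.map p t = X.map p t')
    (h₂ : X.map q t = X.map q t') : t = t' := by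
  obtain ⟨hsheaf, ι, A, j, hj⟩ := hX
  have hp : IsNilThickening (toAlgHom p : E →+* S) := IsFibreSquare.isNilThickening_fst
    (q := (toAlgHom q : E →+* W)) (s := (toAlgHom s : S →+* B)) H hw
  obtain ⟨m, f, hf, hcover⟩ := hj.exists_finite hp (X.map p t)
  refine hsheaf.ext hf (𝟙 E) fun k => ?_
  change X.map (E.toAway (f k)) t = X.map (E.toAway (f k)) t'
  obtain ⟨i, hi⟩ := hcover k
  refine (hj.1 i).eq_of_isFibreSquare ((H.awayMap rfl rfl rfl (H.comm (f k)).symm).spf _)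
    (hp.awayMap rfl) ?_ ?_ ?_
  · rwa [map_awayMap_map_toAway]
  · rw [map_awayMap_map_toAway, map_awayMap_map_toAway, h₁]
  · rw [map_awayMap_map_toAway, map_awayMap_map_toAway, h₂]

theorem eq_of_agreeOver (hX : IsFormalScheme X)
    (H : IsFibreSquare (toAlgHom p) (toAlgHom q) (toAlgHom s) (toAlgHom w))
    (hw : IsNilThickening (toAlgHom w : W →+* B)) {a : X.obj S} {b : X.obj W} {e : E}
    {t t' : X.obj (E.away e)} (ha : AgreeOver X (E.toAway e) p t a)
    (hb : AgreeOver X (E.toAway e) q t b) (ha' : AgreeOver X (E.toAway e) p t' a)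
    (hb' : AgreeOver X (E.toAway e) q t' b) : t = t' := by
  refine hX.eq_of_isFibreSquare (H.awayMap rfl rfl rfl (H.comm e).symm) (hw.awayMap _) ?_ ?_
  · exact (ha _ _ (toAway_awayMap p rfl)).trans (ha' _ _ (toAway_awayMap p rfl)).symm
  · exact (hb _ _ (toAway_awayMap q rfl)).trans (hb' _ _ (toAway_awayMap q rfl)).symm

theorem exists_local_agreeOver (hX : IsFormalScheme X)
    (H : IsFibreSquare (toAlgHom p) (toAlgHom q) (toAlgHom s) (toAlgHom w))
    (hw : IsNilThickening (toAlgHom w : W →+* B)) {a : X.obj S} {b : X.obj W}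
    (hab : X.map s a = X.map w b) : ∃ (m : ℕ) (f : Fin m → E), Ideal.span (Set.range f) = ⊤ ∧
      ∀ k, ∃ t : X.obj (E.away (f k)),
        AgreeOver X (E.toAway (f k)) p t a ∧ AgreeOver X (E.toAway (f k)) q t b := by
  obtain ⟨-, ι, A, j, hj⟩ := hX
  obtain ⟨m, f, hf, hcover⟩ := hj.exists_finite (IsFibreSquare.isNilThickening_fst
    (p := (toAlgHom p : E →+* S)) (q := (toAlgHom q : E →+* W)) (s := (toAlgHom s : S →+* B)) H hw)
    a
  refine ⟨m, f, hf, fun k => ?_⟩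
  obtain ⟨i, hi⟩ := hcover k
  obtain ⟨t, hta, htb⟩ := (hj.1 i).exists_of_isFibreSquare
    ((H.awayMap rfl rfl rfl (H.comm (f k)).symm).spf _) (hw.awayMap _) hi
    (b := X.map (W.toAway _) b) (by rw [map_awayMap_map_toAway, map_awayMap_map_toAway, hab])
  exact ⟨t, .of_toAway hta, .of_toAway htb⟩

theorem exists_of_isFibreSquare (hX : IsFormalScheme X)
    (H : IsFibreSquare (toAlgHom p) (toAlgHom q) (toAlgHom s) (toAlgHom w))
    (hw : IsNilThickening (toAlgHom w : W →+* B)) {a : X.obj S} {b : X.obj W}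
    (hab : X.map s a = X.map w b) : ∃ t, X.map p t = a ∧ X.map q t = b := by
  obtain ⟨m, f, hf, hloc⟩ := hX.exists_local_agreeOver H hw hab
  choose t ha hb using hloc
  obtain ⟨τ, hτ⟩ := hX.1.exists_glue hf t fun k l => .toAway_toAway fun g h hg hh =>
    hX.eq_of_agreeOver H hw (a := a) (b := b) (hg ▸ (ha k).map_left g) (hg ▸ (hb k).map_left g)
      (hh ▸ (ha l).map_left h) (hh ▸ (hb l).map_left h)
  have hτ_map {D : NilpAlg π R} {g : E ⟶ D} {d : X.obj D}
      (hd : ∀ k, AgreeOver X (E.toAway (f k)) g (t k) d) : X.map g τ = d :=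
    hX.1.ext hf g fun k => by
      rw [← map_awayMap_map_toAway X g rfl, hτ]
      exact hd k _ _ (toAway_awayMap g rfl)
  exact ⟨τ, hτ_map ha, hτ_map hb⟩

theorem isFibreSquare_map (hX : IsFormalScheme X)
    (H : IsFibreSquare (toAlgHom p) (toAlgHom q) (toAlgHom s) (toAlgHom w))
    (hw : IsNilThickening (toAlgHom w : W →+* B)) :
    IsFibreSquare (X.map p) (X.map q) (X.map s) (X.map w) where
  comm t := by
    rw [← Functor.map_comp_apply, ← Functor.map_comp_apply]
    exact congrArg (fun g => X.map g t) (AlgHom.ext H.comm)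
  ext := hX.eq_of_isFibreSquare H hw
  exists_eq := hX.exists_of_isFibreSquare H hw

end IsFormalScheme

end FormalSchemeFibreSquare

section WittNilpotence

variable {O : Type v} [CommRing O] {π : O} [IsUniformizer π] {n : ℕ}

theorem ghost_zero_left {A : Type*} [CommRing A] [Algebra O A] (i : ℕ) :
    ghost π (0 : Fin (n + 1) → A) i = 0 := by
  refine Finset.sum_eq_zero fun j _ => ?_
  rw [Pi.zero_apply, zero_pow (pow_pos (residueCard_pos π) _).ne', mul_zero, ite_self]

theorem dvd_ghost {A : Type*} [CommRing A] [Algebra O A] {a : Fin (n + 1) → A}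
    (ha : algebraMap O A π ∣ a 0) (i : ℕ) : algebraMap O A π ∣ ghost π a i := by
  refine Finset.dvd_sum fun j _ => ?_
  split_ifs with hji
  · rcases eq_or_ne j 0 with rfl | hj
    · exact (dvd_pow ha (pow_pos (residueCard_pos π) _).ne').mul_left _
    · exact (dvd_pow_self _ (Fin.val_ne_zero_iff.2 hj)).mul_right _
  · exact dvd_zero _

theorem pow_dvd_of_pow_dvd_ghost {A : Type*} [CommRing A] [Algebra O A]
    (hA : IsLeftRegular (algebraMap O A π)) {k : ℕ} (hk : n ≤ k) {a : Fin (n + 1) → A}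
    (h : ∀ i ≤ n, algebraMap O A π ^ k ∣ ghost π a i) (i : Fin (n + 1)) :
    algebraMap O A π ^ (k - i) ∣ a i := by
  induction i using WellFoundedLT.induction with
  | _ i ih =>
    have hi : (i : ℕ) ≤ n := Nat.lt_succ_iff.1 i.2
    have hghost := h i hi
    rw [ghost, ← Finset.add_sum_erase _ _ (Finset.mem_univ i), if_pos le_rfl, Nat.sub_self,
      pow_zero, pow_one] at hghost
    have hterm : algebraMap O A π ^ k ∣ algebraMap O A π ^ (i : ℕ) * a i := by
      refine (dvd_add_left (Finset.dvd_sum fun j hj => ?_)).1 hghost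
      split_ifs with hji
      · have hlt : j < i := lt_of_le_of_ne hji (Finset.ne_of_mem_erase hj)
        rw [← Nat.add_sub_of_le (hji.trans (hi.trans hk)), pow_add]
        exact mul_dvd_mul_left _ (dvd_pow (ih j hlt) (pow_pos (residueCard_pos π) _).ne')
      · exact dvd_zero _
    rwa [← Nat.add_sub_of_le (hi.trans hk), pow_add, (hA.pow i).dvd_cancel_left] at hterm

variable [IsDomain O]

variable (π) in
theorem isLeftRegular_algebraMap_mvPolynomial (σ : Type*) :
    IsLeftRegular (algebraMap O (MvPolynomial σ O) π) :=
  (IsRegular.of_ne_zero (MvPolynomial.C_eq_zero.not.2 (IsUniformizer.prime (π := π)).ne_zero)).left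

namespace Witt

variable {B : Type*} [CommRing B] [Algebra O B]

theorem coeff_zero (i : Fin (n + 1)) : (0 : Witt π n B).coeff i = 0 := by
  have structPoly_zero : structPoly π n (0 : MvPolynomial Empty O) = 0 :=
    ghost_injective π
      (fun _ => (isLeftRegular_algebraMap_mvPolynomial π _).mul_left_eq_zero_iff.1) fun i hi => by
        rw [ghost_structPoly π n 0 hi, map_zero, ghost_zero_left]
  exact (congrArg (MvPolynomial.aeval _) (congrFun structPoly_zero i)).trans (map_zero _)

/- `a` is the image of the generic vector `(0, X₁, …, Xₙ)`, whose ghost components are divisible by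
`π`; those of its `m`-th power are then divisible by `π ^ m`, over a ring without `π`-torsion. -/
theorem isNilpotent_of_coeff_zero (hB : IsNilpotent (algebraMap O B π)) {a : Witt π n B}
    (ha : a.coeff 0 = 0) : IsNilpotent a := by
  obtain ⟨N, hN⟩ := hB
  let f : MvPolynomial (Fin (n + 1)) O →ₐ[O] B := MvPolynomial.aeval a.coeff
  let c : Witt π n (MvPolynomial (Fin (n + 1)) O) := ⟨Function.update MvPolynomial.X 0 0⟩
  have c_zero : c.coeff 0 = 0 := Function.update_self (0 : Fin (n + 1)) _ MvPolynomial.X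
  have map_c : map f c = a := Witt.ext <| funext fun i => by
    change f (Function.update MvPolynomial.X 0 0 i) = a.coeff i
    rcases eq_or_ne i 0 with rfl | hi
    · rw [Function.update_self, map_zero, ha]
    · rw [Function.update_of_ne hi, MvPolynomial.aeval_X]
  have dvd_coeff := pow_dvd_of_pow_dvd_ghost (isLeftRegular_algebraMap_mvPolynomial π _)
    (Nat.le_add_left n N) (a := (c ^ (N + n)).coeff) fun i hi => by
      have ghost_pow : ghost π (c ^ (N + n)).coeff i = ghost π c.coeff i ^ (N + n) :=
        map_pow (ghostHom ⟨i, Nat.lt_succ_of_le hi⟩) c (N + n)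
      exact ghost_pow ▸ pow_dvd_pow_of_dvd (dvd_ghost (c_zero ▸ dvd_zero _) i) _
  refine ⟨N + n, ?_⟩
  rw [← map_c, ← map_pow]
  ext i
  rw [coeff_zero]
  change f ((c ^ (N + n)).coeff i) = 0
  obtain ⟨d, hd⟩ := dvd_coeff i
  rw [hd, map_mul, map_pow, AlgHom.commutes,
    pow_eq_zero_of_le (by have := i.2; omega) hN, zero_mul]

end Witt

theorem isNilThickening_w₀ {R : Type u} [CommRing R] [Algebra O R] [FrobeniusBase π R] (n : ℕ)
    (B : NilpAlg π R) : IsNilThickening (Witt.w₀ π R n B : B.witt n →+* B) where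
  surjective b := ⟨⟨fun _ => b⟩, rfl⟩
  ker_le _ ha := Witt.isNilpotent_of_coeff_zero (O := O) B.isNilpotent ha

end WittNilpotence

section Filtrations

variable {O : Type v} [CommRing O] {π : O} {R : Type u} [CommRing R] [Algebra O R]
variable {A : Type u} [CommRing A] [Algebra R A]

namespace NilpAlg

/-- The quotient of an `R`-algebra by an ideal that is open for the `π`-adic topology. -/
abbrev quotient (J : Ideal A) (hJ : ∃ m, piIdeal π R A ^ m ≤ J) : NilpAlg π R where
  carrier := A ⧸ J
  isNilpotent := by
    obtain ⟨m, hm⟩ := hJ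
    refine ⟨m, ?_⟩
    rw [← Ideal.Quotient.mk_algebraMap, ← map_pow, Ideal.Quotient.eq_zero_iff_mem]
    exact hm (Ideal.pow_mem_pow (Ideal.mem_span_singleton_self _) m)

variable {J : Ideal A} {hJ : ∃ m, piIdeal π R A ^ m ≤ J} {C : NilpAlg π R}

/-- The homomorphism `A ⧸ J → C` induced by a homomorphism `A → C` that kills `J`. -/
def quotientLift (f : A →ₐ[R] C) (hf : J ≤ RingHom.ker f) : quotient J hJ ⟶ C :=
  Ideal.Quotient.liftₐ J f hf

theorem quotient_hom_ext {f g : quotient J hJ ⟶ C}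
    (h : (toAlgHom f).comp (Ideal.Quotient.mkₐ R J) = (toAlgHom g).comp (Ideal.Quotient.mkₐ R J)) :
    f = g :=
  Ideal.Quotient.algHom_ext R h

end NilpAlg

open NilpAlg

variable (π R) in
/-- A decreasing sequence of ideals of `A` that defines the `π`-adic topology. -/
structure IsPiAdicFiltration (J : ℕ → Ideal A) : Prop where
  antitone : Antitone J
  exists_pow_le : ∀ k, ∃ m, piIdeal π R A ^ m ≤ J k
  exists_le_pow : ∀ m, ∃ k, J k ≤ piIdeal π R A ^ m

namespace IsPiAdicFiltration

variable {J : ℕ → Ideal A} {X : NilpAlg π R ⥤ Type u}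

/-- The quotient `A ⧸ J k` as an object of `Nilp_R`. -/
abbrev level (hJ : IsPiAdicFiltration π R J) (k : ℕ) : NilpAlg π R :=
  quotient (J k) (hJ.exists_pow_le k)

/-- The quotient map `A → A ⧸ J k` as a point of `Spf(A)`. -/
def point (hJ : IsPiAdicFiltration π R J) (k : ℕ) : (piSpf π R A).obj (hJ.level k) :=
  piSpfPoint (Ideal.Quotient.mkₐ R (J k))

/-- The transition map `A ⧸ J l → A ⧸ J k`. -/
def transition (hJ : IsPiAdicFiltration π R J) {k l : ℕ} (hkl : k ≤ l) :
    hJ.level l ⟶ hJ.level k :=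
  quotientLift (Ideal.Quotient.mkₐ R (J k)) ((hJ.antitone hkl).trans Ideal.mk_ker.ge)

theorem exists_le_ker (hJ : IsPiAdicFiltration π R J) {C : NilpAlg π R}
    (a : (piSpf π R A).obj C) : ∃ k, J k ≤ RingHom.ker a.1 := by
  obtain ⟨m, hm⟩ := a.2
  obtain ⟨k, hk⟩ := hJ.exists_le_pow m
  exact ⟨k, hk.trans hm⟩

theorem map_quotientLift_app (hJ : IsPiAdicFiltration π R J) {C : NilpAlg π R}
    (f : piSpf π R A ⟶ X) (a : A →ₐ[R] C) {k : ℕ} (hk : J k ≤ RingHom.ker a) :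
    X.map (quotientLift a hk) (f.app (hJ.level k) (hJ.point k)) = f.app C (piSpfPoint a) :=
  (NatTrans.naturality_apply f (quotientLift a hk) (hJ.point k)).symm

theorem hom_ext (hJ : IsPiAdicFiltration π R J) {f g : piSpf π R A ⟶ X}
    (h : ∀ k, f.app (hJ.level k) (hJ.point k) = g.app (hJ.level k) (hJ.point k)) : f = g := by
  refine NatTrans.ext (funext fun C => ConcreteCategory.hom_ext _ _ fun a => ?_)
  obtain ⟨k, hk⟩ := hJ.exists_le_ker a
  refine (hJ.map_quotientLift_app f a.1 hk).symm.trans ?_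
  rw [h]
  exact hJ.map_quotientLift_app g a.1 hk

theorem map_quotientLift_eq (hJ : IsPiAdicFiltration π R J) {t : ∀ k, X.obj (hJ.level k)}
    (ht : ∀ {k l} (hkl : k ≤ l), X.map (hJ.transition hkl) (t l) = t k) {C : NilpAlg π R}
    {a : A →ₐ[R] C} {k l : ℕ} (hk : J k ≤ RingHom.ker a) (hl : J l ≤ RingHom.ker a) :
    X.map (quotientLift (hJ := hJ.exists_pow_le k) a hk) (t k) =
      X.map (quotientLift (hJ := hJ.exists_pow_le l) a hl) (t l) := by
  rw [← ht (le_max_left k l), ← ht (le_max_right k l), ← Functor.map_comp_apply,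
    ← Functor.map_comp_apply]
  exact congrArg (fun g => X.map g (t (max k l))) (quotient_hom_ext rfl)

theorem exists_hom (hJ : IsPiAdicFiltration π R J) {t : ∀ k, X.obj (hJ.level k)}
    (ht : ∀ {k l} (hkl : k ≤ l), X.map (hJ.transition hkl) (t l) = t k) :
    ∃ f : piSpf π R A ⟶ X, ∀ k, f.app (hJ.level k) (hJ.point k) = t k := by
  choose k hk using fun (C : NilpAlg π R) (a : (piSpf π R A).obj C) => hJ.exists_le_ker a
  refine ⟨{ app := fun C => TypeCat.ofHom fun a => X.map (quotientLift a.1 (hk C a)) (t (k C a))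
            naturality := fun C D g => ConcreteCategory.hom_ext _ _ fun a => ?_ }, fun l => ?_⟩
  · have hak : J (k C a) ≤ RingHom.ker ((piSpf π R A).map g a).1 := fun x hx =>
      (congrArg (toAlgHom g) (hk C a hx)).trans (map_zero _)
    have lift_eq : quotientLift (hJ := hJ.exists_pow_le _) ((piSpf π R A).map g a).1 hak =
        quotientLift a.1 (hk C a) ≫ g := quotient_hom_ext rfl
    refine (hJ.map_quotientLift_eq ht (hk D _) hak).trans ?_
    rw [lift_eq, Functor.map_comp_apply]
    rfl
  · exact (hJ.map_quotientLift_eq ht (hk _ _) Ideal.mk_ker.ge).trans (ht le_rfl)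

end IsPiAdicFiltration

end Filtrations

section FibreProducts

open NilpAlg

variable {O : Type v} [CommRing O] {π : O} {R : Type u} [CommRing R] [Algebra O R]
variable {E S : Type u} [CommRing E] [Algebra R E] [CommRing S] [Algebra R S] {W B : NilpAlg π R}
variable {p : E →ₐ[R] S} {q : E →ₐ[R] W} {s : S →ₐ[R] B} {w : W ⟶ B}

variable (p q) in
/-- The ideal `I × 0` of a fibre product `E = S ×_B W`, for an ideal `I` of `S`. -/
def fibreIdeal (I : Ideal S) : Ideal E := I.comap p ⊓ RingHom.ker q

/-- The projection `E ⧸ (I × 0) → S ⧸ I`. -/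
def quotientFst {I : Ideal S} (hJ : ∃ m, piIdeal π R E ^ m ≤ fibreIdeal p q I)
    (hI : ∃ m, piIdeal π R S ^ m ≤ I) :
    NilpAlg.quotient (fibreIdeal p q I) hJ ⟶ NilpAlg.quotient I hI :=
  quotientLift ((Ideal.Quotient.mkₐ R I).comp p) fun _ h => Ideal.Quotient.eq_zero_iff_mem.2 h.1

/-- The projection `E ⧸ (I × 0) → W`. -/
def quotientSnd {I : Ideal S} (hJ : ∃ m, piIdeal π R E ^ m ≤ fibreIdeal p q I) :
    NilpAlg.quotient (fibreIdeal p q I) hJ ⟶ W :=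
  quotientLift q fun _ h => h.2

theorem IsFibreSquare.quotient (H : IsFibreSquare p q s (toAlgHom w)) {I : Ideal S}
    (hJ : ∃ m, piIdeal π R E ^ m ≤ fibreIdeal p q I) (hI : ∃ m, piIdeal π R S ^ m ≤ I)
    (hs : I ≤ RingHom.ker s) :
    IsFibreSquare (toAlgHom (quotientFst hJ hI)) (toAlgHom (quotientSnd hJ))
      (toAlgHom (quotientLift (hJ := hI) s hs)) (toAlgHom w) where
  comm := Ideal.Quotient.mk_surjective.forall.2 H.comm
  ext {z z'} h₁ h₂ := by
    obtain ⟨e, rfl⟩ := Ideal.Quotient.mk_surjective z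
    obtain ⟨e', rfl⟩ := Ideal.Quotient.mk_surjective z'
    refine Ideal.Quotient.eq.2 ⟨?_, ?_⟩
    · rw [SetLike.mem_coe, Ideal.mem_comap, map_sub]
      exact Ideal.Quotient.eq.1 h₁
    · exact (RingHom.sub_mem_ker_iff q).2 h₂
  exists_eq {a b} hab := by
    obtain ⟨a, rfl⟩ := Ideal.Quotient.mk_surjective a
    obtain ⟨e, rfl, rfl⟩ := H.exists_eq hab
    exact ⟨Ideal.Quotient.mk _ e, rfl, rfl⟩

theorem isPiAdicFiltration_pow (A : Type u) [CommRing A] [Algebra R A] (N : ℕ) :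
    IsPiAdicFiltration π R fun k => piIdeal π R A ^ (N + k) where
  antitone _ _ hkl := Ideal.pow_le_pow_right (by lia)
  exists_pow_le k := ⟨N + k, le_rfl⟩
  exists_le_pow m := ⟨m, Ideal.pow_le_pow_right (by lia)⟩

theorem IsFibreSquare.isPiAdicFiltration_fibreIdeal (H : IsFibreSquare p q s (toAlgHom w)) {N : ℕ}
    (hN : algebraMap R B (algebraMap O R π) ^ N = 0) :
    IsPiAdicFiltration π R fun k => fibreIdeal p q (piIdeal π R S ^ (N + k)) where
  antitone _ _ hkl := inf_le_inf_right _ (Ideal.comap_mono (Ideal.pow_le_pow_right (by lia)))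
  exists_pow_le k := by
    obtain ⟨m, hm⟩ := (piSpfPoint q).2
    refine ⟨max m (N + k), le_inf ?_ ((Ideal.pow_le_pow_right (le_max_left _ _)).trans hm)⟩
    rw [← Ideal.map_le_iff_le_comap, Ideal.map_pow, piIdeal, Ideal.map_span, Set.image_singleton,
      AlgHom.commutes]
    exact Ideal.pow_le_pow_right (le_max_right _ _)
  exists_le_pow m := by
    refine ⟨m, fun e he => ?_⟩
    have dvd_fst : p (algebraMap R E (algebraMap O R π)) ^ (N + m) ∣ p e := by
      rw [AlgHom.commutes, ← Ideal.mem_span_singleton, ← Ideal.span_singleton_pow]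
      exact he.1
    rw [piIdeal, Ideal.span_singleton_pow, Ideal.mem_span_singleton]
    exact IsFibreSquare.pow_dvd (p := (p : E →+* S)) (q := (q : E →+* W)) (s := (s : S →+* B))
      (w := (toAlgHom w : W →+* B)) H (by simpa only [RingHom.coe_coe, AlgHom.commutes] using hN)
      dvd_fst he.2

theorem piIdeal_pow_le_ker {N : ℕ} (hN : algebraMap R B (algebraMap O R π) ^ N = 0) (k : ℕ)
    (s : S →ₐ[R] B) : piIdeal π R S ^ (N + k) ≤ RingHom.ker s := by
  rw [piIdeal, Ideal.span_singleton_pow, Ideal.span_singleton_le_iff_mem, RingHom.mem_ker, map_pow,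
    AlgHom.commutes, pow_add, hN, zero_mul]

end FibreProducts

section HomFibreSquare

open NilpAlg

variable {O : Type v} [CommRing O] {π : O} {R : Type u} [CommRing R] [Algebra O R]
variable {E S : Type u} [CommRing E] [Algebra R E] [CommRing S] [Algebra R S] {W B : NilpAlg π R}
variable {p : E →ₐ[R] S} {q : E →ₐ[R] W} {s : S →ₐ[R] B} {w : W ⟶ B}
variable {X : NilpAlg π R ⥤ Type u} {I : ℕ → Ideal S}

namespace IsFormalScheme

theorem hom_ext (hX : IsFormalScheme X) (H : IsFibreSquare p q s (toAlgHom w))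
    (hw : IsNilThickening (toAlgHom w : W →+* B))
    (hE : IsPiAdicFiltration π R fun k => fibreIdeal p q (I k)) (hS : IsPiAdicFiltration π R I)
    (hs : ∀ k, I k ≤ RingHom.ker s) {f g : piSpf π R E ⟶ X}
    (h₁ : piSpfMap p ≫ f = piSpfMap p ≫ g)
    (h₂ : f.app W (piSpfPoint q) = g.app W (piSpfPoint q)) : f = g := by
  have square (k : ℕ) := hX.isFibreSquare_map
    (H.quotient (hE.exists_pow_le k) (hS.exists_pow_le k) (hs k)) hw
  refine hE.hom_ext fun k => (square k).ext ?_ ?_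
  · exact (hE.map_quotientLift_app f _ _).trans <|
      (congrArg (fun h => h.app (hS.level k) (hS.point k)) h₁).trans
        (hE.map_quotientLift_app g _ _).symm
  · exact (hE.map_quotientLift_app f q _).trans (h₂.trans (hE.map_quotientLift_app g q _).symm)

theorem exists_hom (hX : IsFormalScheme X) (H : IsFibreSquare p q s (toAlgHom w))
    (hw : IsNilThickening (toAlgHom w : W →+* B))
    (hE : IsPiAdicFiltration π R fun k => fibreIdeal p q (I k)) (hS : IsPiAdicFiltration π R I)
    (hs : ∀ k, I k ≤ RingHom.ker s) {a : piSpf π R S ⟶ X} {b : X.obj W}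
    (hab : a.app B (piSpfPoint s) = X.map w b) :
    ∃ f : piSpf π R E ⟶ X, piSpfMap p ≫ f = a ∧ f.app W (piSpfPoint q) = b := by
  have square (k : ℕ) := hX.isFibreSquare_map
    (H.quotient (hE.exists_pow_le k) (hS.exists_pow_le k) (hs k)) hw
  choose t hta htb using fun k => (square k).exists_eq
    (a := a.app (hS.level k) (hS.point k)) ((hS.map_quotientLift_app a s _).trans hab)
  have compatible {k l : ℕ} (hkl : k ≤ l) : X.map (hE.transition hkl) (t l) = t k := by
    refine (square k).ext ?_ ?_
    · have : hE.transition hkl ≫ quotientFst (hE.exists_pow_le k) (hS.exists_pow_le k) =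
          quotientFst (hE.exists_pow_le l) (hS.exists_pow_le l) ≫ hS.transition hkl :=
        quotient_hom_ext rfl
      rw [← Functor.map_comp_apply, this, Functor.map_comp_apply, hta, hta]
      exact hS.map_quotientLift_app a _ _
    · have : hE.transition hkl ≫ quotientSnd (hE.exists_pow_le k) =
          quotientSnd (hE.exists_pow_le l) := quotient_hom_ext rfl
      rw [← Functor.map_comp_apply, this, htb, htb]
  obtain ⟨f, hf⟩ := hE.exists_hom compatible
  refine ⟨f, hS.hom_ext fun k => ?_, ?_⟩
  · rw [← hta, ← hf]
    exact (hE.map_quotientLift_app f _ _).symm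
  · rw [← htb 0, ← hf]
    exact (hE.map_quotientLift_app f _ _).symm

theorem isFibreSquare_hom (hX : IsFormalScheme X) (H : IsFibreSquare p q s (toAlgHom w))
    (hw : IsNilThickening (toAlgHom w : W →+* B)) :
    IsFibreSquare (fun f : piSpf π R E ⟶ X => piSpfMap p ≫ f) (fun f => f.app W (piSpfPoint q))
      (fun g : piSpf π R S ⟶ X => g.app B (piSpfPoint s)) (X.map w) := by
  obtain ⟨N, hN⟩ := B.isNilpotent
  have hE := H.isPiAdicFiltration_fibreIdeal hN
  have hS := isPiAdicFiltration_pow (π := π) (R := R) S N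
  have hs k := piIdeal_pow_le_ker hN k s
  refine ⟨fun f => ?_, hX.hom_ext H hw hE hS hs, hX.exists_hom H hw hE hS hs⟩
  refine Eq.trans ?_ (NatTrans.naturality_apply f w (piSpfPoint q))
  exact congrArg (f.app B) (Subtype.ext (AlgHom.ext H.comm))

end IsFormalScheme

end HomFibreSquare

section JetFibre

open NilpAlg

variable {O : Type v} [CommRing O] [IsDomain O] {π : O} [IsUniformizer π]
variable {R : Type u} [CommRing R] [Algebra O R] [FrobeniusBase π R]

namespace ShiftedWitt

variable (n : ℕ) (B : NilpAlg π R)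

theorem isFibreSquare : IsFibreSquare (augmentation n B) (toWitt n B) (Algebra.ofId R B)
    (toAlgHom ((wittProj π R n).app B)) where
  comm a := a.2
  ext h₁ h₂ := Subtype.ext (Prod.ext h₁ h₂)
  exists_eq {a b} hab := ⟨⟨(a, b), hab⟩, rfl, rfl⟩

theorem isAdicComplete : IsAdicComplete (piIdeal π R (ShiftedWitt n B)) (ShiftedWitt n B) := by
  have : IsAdicComplete (Ideal.span {augmentation n B (algebraMap R _ (algebraMap O R π))}) R := by
    rw [AlgHom.commutes]
    exact FrobeniusBase.complete (π := π)
  refine IsFibreSquare.isAdicComplete (p := (augmentation n B : ShiftedWitt n B →+* R))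
    (q := (toWitt n B : ShiftedWitt n B →+* Witt π n B)) (s := (Algebra.ofId R B : R →+* B))
    (w := (Witt.w₀ π R n B : Witt π n B →+* B)) (isFibreSquare n B) _ (hS := this) ?_
  rw [RingHom.coe_coe, AlgHom.commutes]
  exact (B.witt n).isNilpotent

end ShiftedWitt

namespace PointedHom

variable {X : NilpAlg π R ⥤ Type u} {x : piSpf π R R ⟶ X} {n : ℕ} {B : NilpAlg π R}

theorem toJetFibre_bijective (hX : IsFormalScheme X) :
    Function.Bijective (toJetFibre : PointedHom n x B → (jetFibre n x).obj B) := by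
  have H := hX.isFibreSquare_hom (ShiftedWitt.isFibreSquare n B) (isNilThickening_w₀ n B)
  refine ⟨fun f f' h => Subtype.ext ?_, fun y => ?_⟩
  · exact H.ext (f.2.trans f'.2.symm) (congrArg Subtype.val h)
  · obtain ⟨f, hfx, hfy⟩ := H.exists_eq (a := x) (b := y.1) y.2.symm
    exact ⟨⟨f, hfx⟩, Subtype.ext hfy⟩

theorem toJetFibre_map {C : NilpAlg π R} (g : B ⟶ C) (f : PointedHom n x B) :
    (f.map g).toJetFibre = (jetFibre n x).map g f.toJetFibre :=
  Subtype.ext (NatTrans.naturality_apply f.1 ((wittFunctor π R n).map g)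
    (piSpfPoint (ShiftedWitt.toWitt n B)) :)

end PointedHom

end JetFibre

end PiJet

theorem theoremt_general {O : Type v} [CommRing O] [IsDomain O] {π : O} [IsUniformizer π]
    {R : Type u} [CommRing R] [Algebra O R] [FrobeniusBase π R] (X : NilpAlg π R ⥤ Type u)
    (hX : IsFormalScheme X) (x : piSpf π R R ⟶ X) (n : ℕ) (B : NilpAlg π R) :
    IsAdicComplete (piIdeal π R (ShiftedWitt n B)) (ShiftedWitt n B) ∧
    Function.Bijective (PointedHom.toJetFibre : PointedHom n x B → (jetFibre n x).obj B) ∧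
    ∀ (C : NilpAlg π R) (g : B ⟶ C) (f : PointedHom n x B),
      (f.map g).toJetFibre = (jetFibre n x).map g f.toJetFibre :=
  ⟨ShiftedWitt.isAdicComplete n B, PointedHom.toJetFibre_bijective hX,
    fun _ => PointedHom.toJetFibre_map⟩

theorem theoremt
    -- `K` is a finite extension of `ℚ_p`, with uniformizer `π` of its ring of integers
    {p : ℕ} [Fact p.Prime] {K : Type v} [Field K] [Algebra ℚ_[p] K] [Algebra ℤ_[p] K]
    [IsScalarTower ℤ_[p] ℚ_[p] K] [FiniteDimensional ℚ_[p] K]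
    {π : PadicIntegers p K} [Fact (Prime π)]
    -- the base ring with its lift of Frobenius
    {R : Type u} [CommRing R] [Algebra (PadicIntegers p K) R] [FrobeniusBase π R]
    -- a smooth formal scheme with a marked point
    (X : NilpAlg π R ⥤ Type u) (hX : IsSmoothFormalScheme X) (x : piSpf π R R ⟶ X)
    (n : ℕ) (B : NilpAlg π R) :
    -- `W_n⁺(B)` is a `π`-adic `R`-algebra
    IsAdicComplete (piIdeal π R (ShiftedWitt n B)) (ShiftedWitt n B) ∧
    -- the canonical map `Hom_pt(Spf(W_n⁺(B)), X) → N^n X (B)` is bijective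
    Function.Bijective (PointedHom.toJetFibre : PointedHom n x B → (jetFibre n x).obj B) ∧
    -- and natural in `B`
    ∀ (C : NilpAlg π R) (g : B ⟶ C) (f : PointedHom n x B),
      (f.map g).toJetFibre = (jetFibre n x).map g f.toJetFibre :=
  theoremt_general X hX.1 x n B
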